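/- Let $\mathcal H_A,\mathcal H_B$ be separable complex Hilbert spaces (of finite or infinite dimension), let $\Phi\in\mathcal H_A\otimes\mathcal H_B$ be a unit vector with reduced density $\rho=\mathrm{Tr}_B|\Phi\rangle\langle\Phi|$, and for real $x$ put $h(x)=\mathrm{Tr}\,(\rho-x)\{\rho-x\ge 0\}$, where $\{\rho-x\ge 0\}$ is the spectral projection of $\rho-x$ for $[0,\infty)$. A unit vector $\Psi\in\mathcal H_A\otimes\mathcal H_B$ is called a maximally entangled state of size $L$ if its reduced density on $\mathcal H_A$ equals $\frac1L$ times the orthogonal projection onto an $L$-dimensional subspace. A probabilistic fixed-length entanglement concentration (PFLEC) of $\Phi$ is a two-valued instrument $I=\{I_0,I_1\}$ ($1$ = success, $0$ = failure) on $\mathcal H_A\otimes\mathcal H_B$ that is implemented by local operations and classical communication (LOCC) and for which $I_1(|\Phi\rangle\langle\Phi|)/\mathrm{Tr}\,I_1(|\Phi\rangle\langle\Phi|)$ is a maximally entangled pure state; the size of that state is denoted by $L(I)$. Here an LOCC implementation consists of finitely many rounds; in each round one of the two parties performs a local measurement (with countably many outcomes) that may depend on all earlier outcomes, and announces its outcome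 to the other party; at the end a value in $\{0,1\}$ is determined by the outcomes. Then, for every real $x$ with $0<x\le\lambda_{\max}(\rho)$, where $\lambda_{\max}(\rho)$ is the largest eigenvalue of $\rho$, $$\max\bigl\{L(I)\;:\; I=\{I_0,I_1\}\text{ is a PFLEC of }\Phi,\ \mathrm{Tr}\,I_0(|\Phi\rangle\langle\Phi|)\le h(x)\bigr\}=\Bigl\lfloor\frac{1-h(x)}{x}\Bigr\rfloor ,$$ and in particular the maximum is attained. -/

import Mathlib

open scoped TensorProduct InnerProductSpace

universe u v

/-- A quantum system: a separable complex Hilbert space (of finite or infinite dimension). -/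
structure QSystem where
  carrier : Type u
  [normedAddCommGroup : NormedAddCommGroup carrier]
  [innerProductSpace : InnerProductSpace ℂ carrier]
  [completeSpace : CompleteSpace carrier]
  [separableSpace : TopologicalSpace.SeparableSpace carrier]

namespace QSystem

instance : CoeSort QSystem.{u} (Type u) := ⟨QSystem.carrier⟩

attribute [instance] normedAddCommGroup innerProductSpace completeSpace separableSpace

end QSystem

namespace Entanglement

noncomputable section

/-- The Hilbert space tensor product `A ⊗ B`: the completion of the algebraic tensor product for
the inner product `⟪a ⊗ b, a' ⊗ b'⟫ = ⟪a, a'⟫ * ⟪b, b'⟫`. -/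
abbrev Tensor (A : QSystem.{u}) (B : QSystem.{v}) : Type (max u v) :=
  UniformSpace.Completion ((A : Type u) ⊗[ℂ] (B : Type v))

/-- Bounded operators on `A ⊗ B`. -/
abbrev Op (A : QSystem.{u}) (B : QSystem.{v}) : Type (max u v) :=
  Tensor A B →L[ℂ] Tensor A B

/-- The operator `X ⊗ Y` on the Hilbert space tensor product. -/
def tensorOp {A A₁ : QSystem.{u}} {B B₁ : QSystem.{v}}
    (X : A →L[ℂ] A₁) (Y : B →L[ℂ] B₁) : Tensor A B →L[ℂ] Tensor A₁ B₁ :=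
  (TensorProduct.mapL X Y).completion

/-- The operator `a ↦ a ⊗ b`, from `A` to `A ⊗ B`. -/
def tensorRight (A : QSystem.{u}) {B : QSystem.{v}} (b : B) : A →L[ℂ] Tensor A B :=
  UniformSpace.Completion.toComplL ∘L (TensorProduct.mkL ℂ A B).flip b

/-- The (non-normalized) pure state `|ψ⟩⟨ψ|`. -/
def pureState {H : Type*} [NormedAddCommGroup H] [InnerProductSpace ℂ H] (ψ : H) : H →L[ℂ] H :=
  InnerProductSpace.rankOne ℂ ψ ψ

section Trace

variable (H : Type*) [NormedAddCommGroup H] [InnerProductSpace ℂ H] [CompleteSpace H]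

/-- The index set of a Hilbert basis of `H`. -/
def basisIndex : Set H := (exists_hilbertBasis ℂ H).choose

/-- A Hilbert basis of `H`. -/
def basis : HilbertBasis (basisIndex H) ℂ H := (exists_hilbertBasis ℂ H).choose_spec.choose

variable {H}

/-- The trace `∑ i, ⟪e i, T (e i)⟫` of a trace class operator `T` (the sum does not depend on the
Hilbert basis `e`). It is only used for positive trace class operators. -/
def trace (T : H →L[ℂ] H) : ℂ := ∑' i, ⟪basis H i, T (basis H i)⟫_ℂ

end Trace

/-- The partial trace `∑ j, (1 ⊗ ⟨f j|) T (1 ⊗ |f j⟩)` over `B` of a trace class operator `T`, for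
a Hilbert basis `f` of `B` (on which the sum does not depend). It is only used for pure states, for
which the series converges absolutely in operator norm. -/
def partialTrace {A : QSystem.{u}} {B : QSystem.{v}} (T : Op A B) : A →L[ℂ] A :=
  ∑' j, (ContinuousLinearMap.adjoint (tensorRight A (basis B j)) ∘L T) ∘L
    tensorRight A (basis B j)

/-- The reduced density `ρ = Tr_B |Φ⟩⟨Φ|` of a vector `Φ` of `A ⊗ B`. -/
def reducedDensity {A : QSystem.{u}} {B : QSystem.{v}} (Φ : Tensor A B) : A →L[ℂ] A :=
  partialTrace (pureState Φ)

/-- The function `h(x) = Tr (ρ - x){ρ - x ≥ 0}`, where `{ρ - x ≥ 0}` is the spectral projection of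
`ρ - x` for `[0, ∞)`. The operator `(ρ - x){ρ - x ≥ 0}` is the value at `ρ` of the continuous
function `t ↦ (t - x) * 1_{t - x ≥ 0}`. -/
def h {A : QSystem.{u}} (ρ : A →L[ℂ] A) (x : ℝ) : ℝ :=
  (trace (cfc (fun t : ℝ => (t - x) * Set.indicator {s : ℝ | 0 ≤ s - x} 1 t) ρ)).re

/-- `Ψ` is a maximally entangled state of size `L`, on a subspace `V ⊗ W` of `A ⊗ B`: a unit vector
whose reduced density is the completely mixed state on an `L`-dimensional subspace `V` of `A`.
(Then `W` is the support of the reduced density on the other side, which has the same dimension.) -/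
def IsMaximallyEntangled {A : QSystem.{u}} {B : QSystem.{v}} (Ψ : Tensor A B) (L : ℕ) :
    Prop :=
  ‖Ψ‖ = 1 ∧ ∃ (V : Submodule ℂ A) (_ : FiniteDimensional ℂ V),
    Module.finrank ℂ V = L ∧ reducedDensity Ψ = ((L : ℂ)⁻¹) • V.starProjection

/-- A local measurement from `A` to `A₁`: countably many outcomes `j` with measurement (Kraus)
operators `K j` such that `∑ j, (K j)* (K j) = 1`; that is, on every unit vector the outcome
probabilities `‖K j a‖ ^ 2` have sum one. Finitely many outcomes are the case where all but
finitely many `K j` vanish. -/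
structure Measurement (A A₁ : QSystem.{u}) where
  K : ℕ → A →L[ℂ] A₁
  complete : ∀ a : A, HasSum (fun j => ‖K j a‖ ^ 2) (‖a‖ ^ 2)

/-- Two-valued LOCC protocols with at most `n` rounds, from the system `A ⊗ B` to the system
`A' ⊗ B'`. In every round one of the parties performs a measurement on her or his side (the local
system may change, so that ancillas may be added or discarded) and announces the outcome `j`, on
which the remaining protocol `next j` may depend. At the end a value in `{0, 1}` is reported, which
may depend on all the outcomes; everything else is forgotten. A general local operation
`T ↦ ∑ j, K j T (K j)*` is a measurement whose outcome is not used. -/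
inductive LOCC (A' : QSystem.{u}) (B' : QSystem.{v}) :
    ℕ → QSystem.{u} → QSystem.{v} → Type (max (u + 1) (v + 1))
  | finish {n : ℕ} (value : Fin 2) : LOCC A' B' n A' B'
  | alice {n : ℕ} {A : QSystem.{u}} {B : QSystem.{v}} (A₁ : QSystem.{u})
      (M : Measurement A A₁) (next : ℕ → LOCC A' B' n A₁ B) : LOCC A' B' (n + 1) A B
  | bob {n : ℕ} {A : QSystem.{u}} {B : QSystem.{v}} (B₁ : QSystem.{v})
      (M : Measurement B B₁) (next : ℕ → LOCC A' B' n A B₁) : LOCC A' B' (n + 1) A B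

/-- The instrument `{I 0, I 1}` implemented by an LOCC protocol: `I i T` is the non-normalized final
state for the value `i` when the initial state is `T`. For positive trace class `T` all the series
converge absolutely in operator norm. -/
def LOCC.instrument {A' : QSystem.{u}} {B' : QSystem.{v}} :
    ∀ {n : ℕ} {A : QSystem.{u}} {B : QSystem.{v}},
      LOCC A' B' n A B → Fin 2 → Op A B → Op A' B'
  | _, _, _, .finish value, i, T => if i = value then T else 0
  | _, _, B, .alice _ M next, i, T =>
      ∑' j, (next j).instrument i
        ((tensorOp (M.K j) (ContinuousLinearMap.id ℂ B) ∘L T) ∘L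
          ContinuousLinearMap.adjoint (tensorOp (M.K j) (ContinuousLinearMap.id ℂ B)))
  | _, A, _, .bob _ M next, i, T =>
      ∑' j, (next j).instrument i
        ((tensorOp (ContinuousLinearMap.id ℂ A) (M.K j) ∘L T) ∘L
          ContinuousLinearMap.adjoint (tensorOp (ContinuousLinearMap.id ℂ A) (M.K j)))

/-- The two-valued LOCC instrument `I = {I 0, I 1}` implemented by `P` is a probabilistic
fixed-length entanglement concentration of `Φ` whose final maximally entangled state has size `L`:
the normalized state `I 1 (Φ) / Tr I 1 (Φ)` is a maximally entangled pure state of size `L`. -/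
def IsPFLEC {n : ℕ} {A : QSystem.{u}} {B : QSystem.{v}}
    (P : LOCC A B n A B) (Φ : Tensor A B) (L : ℕ) : Prop :=
  ∃ Ψ : Tensor A B, IsMaximallyEntangled Ψ L ∧
    (trace (P.instrument 1 (pureState Φ)))⁻¹ • P.instrument 1 (pureState Φ) = pureState Ψ

/-- The failure probability `Tr I 0 (Φ)`. -/
def failureProb {n : ℕ} {A : QSystem.{u}} {B : QSystem.{v}}
    (P : LOCC A B n A B) (Φ : Tensor A B) : ℝ :=
  (trace (P.instrument 0 (pureState Φ))).re

end

end Entanglement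

/-!
In every branch of an LOCC protocol the state undergoes an operation `X ⊗ Y`, which does not
increase the Schmidt rank, and all branches together preserve the squared norm. Let `χ` be the
truncation of `Φ` to the `k` eigenvalues of `ρ` that are at least `x`, so that
`‖Φ - χ‖ ^ 2 = 1 - h x - k * x`. For `L > k`, a maximally entangled unit vector of size `L` has
squared distance at least `1 - k / L` from the vectors of Schmidt rank at most `k`. Summing over the
successful branches, with total probability `s ≥ 1 - h x`, gives
`s * (1 - k / L) ≤ 1 - h x - k * x`, hence `L * x ≤ 1 - h x`.

Conversely, let `t = 1 - h x` and `L * x ≤ t`. The numbers `q i = L / t * min (p i) x`, for the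
eigenvalues `p i` of `ρ`, are at most `1` and have sum `L`. Systematic sampling realizes them as
inclusion probabilities of a random set of `L` indices: cut `(0, L]` into intervals of lengths `q i`
and take those hit by `u, u + 1, …, u + L - 1` for a uniform `u` in `(0, 1]`. Alice measures which
set of Schmidt vectors to keep, with weights that equalize the Schmidt coefficients; the
probability of success is `t`, and Bob rotates his side according to her outcome.
-/

namespace Entanglement

noncomputable section

section Series

variable {ι κ : Type*} {f : ι → κ → ℝ} {r : ι → ℝ} {s : κ → ℝ} {a : ℝ}

theorem hasSum_comm_of_nonneg (hf : ∀ i j, 0 ≤ f i j) (hr : ∀ i, HasSum (f i) (r i))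
    (ha : HasSum r a) (hs : ∀ j, HasSum (fun i => f i j) (s j)) : HasSum s a := by
  have hsum : Summable fun p : ι × κ => f p.1 p.2 := by
    rw [summable_prod_of_nonneg fun p => hf p.1 p.2]
    exact ⟨fun i => (hr i).summable, by simpa only [fun i => (hr i).tsum_eq] using ha.summable⟩
  have hprod : HasSum (fun p : ι × κ => f p.1 p.2) a := by
    rw [← (hsum.hasSum.prod_fiberwise hr).unique ha]
    exact hsum.hasSum
  have hswap : HasSum (fun p : κ × ι => f p.2 p.1) a := by
    rw [← (Equiv.prodComm ι κ).hasSum_iff]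
    exact hprod
  exact hswap.prod_fiberwise hs

theorem hasSum_tsum_comm_of_nonneg (hf : ∀ i j, 0 ≤ f i j) (hr : ∀ i, HasSum (f i) (r i))
    (ha : HasSum r a) : HasSum (fun j => ∑' i, f i j) a := by
  refine hasSum_comm_of_nonneg hf hr ha fun j => Summable.hasSum ?_
  exact Summable.of_nonneg_of_le (fun i => hf i j)
    (fun i => le_hasSum (hr i) j fun k _ => hf i k) ha.summable

end Series

section HilbertBases

variable {𝕜 H H' ι : Type*} [RCLike 𝕜] [NormedAddCommGroup H] [InnerProductSpace 𝕜 H]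

theorem countable_of_orthonormal [TopologicalSpace.SeparableSpace H] {v : ι → H}
    (hv : Orthonormal 𝕜 v) : Countable ι := by
  refine Pairwise.countable_of_isOpen_disjoint (s := fun i => Metric.ball (v i) (1 / 2)) ?_
    (fun _ => Metric.isOpen_ball) (fun i => ⟨v i, Metric.mem_ball_self (by norm_num)⟩)
  intro i j hij
  refine Metric.ball_disjoint_ball ?_
  have hdist : ‖v i - v j‖ ^ 2 = 2 := by
    rw [@norm_sub_sq 𝕜, hv.2 hij, hv.1, hv.1]
    norm_num
  rw [dist_eq_norm]
  nlinarith [norm_nonneg (v i - v j)]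

theorem hasSum_norm_inner_sq (b : HilbertBasis ι 𝕜 H) (ψ : H) :
    HasSum (fun i => ‖⟪b i, ψ⟫_𝕜‖ ^ 2) (‖ψ‖ ^ 2) := by
  have hre := RCLike.hasSum_re 𝕜 (b.hasSum_inner_mul_inner ψ ψ)
  rw [inner_self_eq_norm_sq] at hre
  refine hre.congr_fun fun i => ?_
  rw [← inner_conj_symm ψ (b i), RCLike.conj_mul]
  norm_cast

theorem clm_ext_hilbertBasis [NormedAddCommGroup H'] [NormedSpace 𝕜 H']
    (b : HilbertBasis ι 𝕜 H) {S T : H →L[𝕜] H'} (h : ∀ i, S (b i) = T (b i)) : S = T := by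
  refine ContinuousLinearMap.ext_on
    (Submodule.dense_iff_topologicalClosure_eq_top.mpr b.dense_span) ?_
  rintro _ ⟨i, rfl⟩
  exact h i

end HilbertBases

section PureState

variable {H H' ι : Type*} [NormedAddCommGroup H] [InnerProductSpace ℂ H]
  [NormedAddCommGroup H'] [InnerProductSpace ℂ H']

theorem pureState_apply (ψ φ : H) : pureState ψ φ = ⟪ψ, φ⟫_ℂ • ψ := rfl

theorem norm_pureState (ψ : H) : ‖pureState ψ‖ = ‖ψ‖ ^ 2 := by
  simp [pureState, sq]

theorem pureState_smul (c : ℂ) (ψ : H) :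
    pureState (c • ψ) = ((‖c‖ ^ 2 : ℝ) : ℂ) • pureState ψ := by
  ext φ
  simp only [pureState_apply, inner_smul_left, _root_.smul_apply, smul_smul]
  rw [mul_right_comm, Complex.conj_mul']
  push_cast
  rfl

theorem inner_pureState_self (ψ φ : H) :
    ⟪φ, pureState ψ φ⟫_ℂ = ((‖⟪φ, ψ⟫_ℂ‖ ^ 2 : ℝ) : ℂ) := by
  rw [pureState_apply, inner_smul_right, ← inner_conj_symm ψ φ, Complex.conj_mul']
  norm_cast

theorem isCompactOperator_pureState (ψ : H) : IsCompactOperator (pureState ψ) := by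
  have hψ : IsCompactOperator (ContinuousLinearMap.toSpanSingleton ℂ ψ : ℂ → H) :=
    isCompactOperator_of_locallyCompactSpace_rng (ContinuousLinearMap.toSpanSingleton ℂ ψ)
  exact hψ.comp_clm (innerSL ℂ ψ)

variable [CompleteSpace H]

theorem comp_pureState_comp_adjoint [CompleteSpace H'] (X : H →L[ℂ] H') (ψ : H) :
    (X ∘L pureState ψ) ∘L ContinuousLinearMap.adjoint X = pureState (X ψ) := by
  ext φ
  simp [pureState_apply, ContinuousLinearMap.adjoint_inner_right]

theorem summable_pureState {v : ι → H} (hv : Summable fun i => ‖v i‖ ^ 2) :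
    Summable fun i => pureState (v i) :=
  .of_norm (by simpa only [norm_pureState] using hv)

theorem isCompactOperator_of_hasSum_pureState {v : ι → H} {T : H →L[ℂ] H}
    (hT : HasSum (fun i => pureState (v i)) T) : IsCompactOperator T := by
  refine isCompactOperator_of_tendsto hT (Filter.Eventually.of_forall fun s => ?_)
  induction s using Finset.cons_induction with
  | empty => simpa using isCompactOperator_zero
  | cons j s hj ih =>
    rw [Finset.sum_cons]
    exact (isCompactOperator_pureState _).add ih

theorem trace_of_hasSum_pureState {v : ι → H} {T : H →L[ℂ] H} {a : ℝ}
    (hv : HasSum (fun i => ‖v i‖ ^ 2) a) (hT : HasSum (fun i => pureState (v i)) T) :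
    trace T = a := by
  have hdiag : ∀ j, HasSum (fun i => ((‖⟪basis H j, v i⟫_ℂ‖ ^ 2 : ℝ) : ℂ))
      ⟪basis H j, T (basis H j)⟫_ℂ := fun j => by
    simp_rw [← inner_pureState_self]
    exact (hT.mapL (.apply ℂ H (basis H j))).mapL (innerSL ℂ (basis H j))
  have hsum := hasSum_tsum_comm_of_nonneg (fun _ _ => by positivity)
    (fun i => hasSum_norm_inner_sq (basis H) (v i)) hv
  rw [trace, ← (Complex.hasSum_ofReal.mpr hsum).tsum_eq]
  refine tsum_congr fun j => ?_
  rw [← (hdiag j).tsum_eq, Complex.ofReal_tsum]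

theorem trace_pureState (ψ : H) : trace (pureState ψ) = ((‖ψ‖ ^ 2 : ℝ) : ℂ) :=
  trace_of_hasSum_pureState (v := fun _ : Unit => ψ) (hasSum_unique _) (hasSum_unique _)

theorem trace_smul (c : ℂ) (T : H →L[ℂ] H) : trace (c • T) = c * trace T := by
  simp only [trace, _root_.smul_apply, inner_smul_right, tsum_mul_left]

end PureState

section Tensor

variable {A A₁ A₂ : QSystem.{u}} {B B₁ B₂ : QSystem.{v}}

/-- The elementary tensor `a ⊗ b`. -/
def tprod (a : A) (b : B) : Tensor A B :=
  ((a ⊗ₜ[ℂ] b : (A : Type u) ⊗[ℂ] (B : Type v)) : Tensor A B)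

/-- The operator `b ↦ a ⊗ b`, from `B` to `A ⊗ B`. -/
def tensorLeft (B : QSystem.{v}) (a : A) : B →L[ℂ] Tensor A B :=
  UniformSpace.Completion.toComplL ∘L TensorProduct.mkL ℂ A B a

/-- The partial inner product `⟨a| ⊗ 1`, from `A ⊗ B` to `B`. -/
def contractLeft (B : QSystem.{v}) (a : A) : Tensor A B →L[ℂ] B :=
  ContinuousLinearMap.adjoint (tensorLeft B a)

/-- The partial inner product `1 ⊗ ⟨b|`, from `A ⊗ B` to `A`. -/
def contractRight (A : QSystem.{u}) (b : B) : Tensor A B →L[ℂ] A :=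
  ContinuousLinearMap.adjoint (tensorRight A b)

theorem tensorLeft_apply (a : A) (b : B) : tensorLeft B a b = tprod a b := rfl

theorem tensorRight_apply (a : A) (b : B) : tensorRight A b a = tprod a b := rfl

theorem tensorOp_tprod (X : A →L[ℂ] A₁) (Y : B →L[ℂ] B₁) (a : A) (b : B) :
    tensorOp X Y (tprod a b) = tprod (X a) (Y b) := by
  simp [tensorOp, tprod, ContinuousLinearMap.completion_apply_coe]

theorem inner_tprod (a a' : A) (b b' : B) :
    ⟪tprod a b, tprod a' b'⟫_ℂ = ⟪a, a'⟫_ℂ * ⟪b, b'⟫_ℂ := by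
  simp [tprod, UniformSpace.Completion.inner_coe]

theorem norm_tprod (a : A) (b : B) : ‖tprod a b‖ = ‖a‖ * ‖b‖ := by
  simp [tprod]

theorem tprod_add_left (a a' : A) (b : B) : tprod (a + a') b = tprod a b + tprod a' b :=
  map_add (tensorRight A b) a a'

theorem tprod_smul_left (c : ℂ) (a : A) (b : B) : tprod (c • a) b = c • tprod a b :=
  map_smul (tensorRight A b) c a

theorem tprod_smul_right (c : ℂ) (a : A) (b : B) : tprod a (c • b) = c • tprod a b :=
  map_smul (tensorLeft B a) c b

theorem inner_contractLeft_right (a : A) (b : B) (φ : Tensor A B) :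
    ⟪b, contractLeft B a φ⟫_ℂ = ⟪tprod a b, φ⟫_ℂ := by
  rw [contractLeft, ContinuousLinearMap.adjoint_inner_right, tensorLeft_apply]

theorem inner_contractRight_right (a : A) (b : B) (φ : Tensor A B) :
    ⟪a, contractRight A b φ⟫_ℂ = ⟪tprod a b, φ⟫_ℂ := by
  rw [contractRight, ContinuousLinearMap.adjoint_inner_right, tensorRight_apply]

theorem contractLeft_tprod (a a' : A) (b : B) :
    contractLeft B a (tprod a' b) = ⟪a, a'⟫_ℂ • b := by
  refine ext_inner_left ℂ fun b' => ?_
  rw [inner_contractLeft_right, inner_tprod, inner_smul_right]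

theorem contractRight_tprod (a : A) (b b' : B) :
    contractRight A b (tprod a b') = ⟪b, b'⟫_ℂ • a := by
  refine ext_inner_left ℂ fun a' => ?_
  rw [inner_contractRight_right, inner_tprod, inner_smul_right, mul_comm]

section Ext

variable {H : Type*} [NormedAddCommGroup H] [NormedSpace ℂ H] {S T : Tensor A B →L[ℂ] H}

theorem clm_ext_tprod (h : ∀ a b, S (tprod a b) = T (tprod a b)) : S = T := by
  ext φ
  induction φ using UniformSpace.Completion.induction_on with
  | hp => exact isClosed_eq S.continuous T.continuous
  | ih t =>
    induction t using TensorProduct.induction_on with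
    | zero => simp only [UniformSpace.Completion.coe_zero, map_zero]
    | tmul a b => exact h a b
    | add s t hs ht => simp only [UniformSpace.Completion.coe_add, map_add, hs, ht]

theorem clm_ext_tprod_hilbertBasis {ι κ : Type*} (e : HilbertBasis ι ℂ A) (f : HilbertBasis κ ℂ B)
    (h : ∀ i j, S (tprod (e i) (f j)) = T (tprod (e i) (f j))) : S = T := by
  have hright : ∀ j, S ∘L tensorRight A (f j) = T ∘L tensorRight A (f j) := fun j =>
    clm_ext_hilbertBasis e fun i => h i j
  have hleft : ∀ a, S ∘L tensorLeft B a = T ∘L tensorLeft B a := fun a =>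
    clm_ext_hilbertBasis f fun j => congrArg (· a) (hright j)
  exact clm_ext_tprod fun a b => congrArg (· b) (hleft a)

end Ext

section Bases

variable {ι κ : Type*}

theorem orthonormal_tprod {v : ι → A} {w : κ → B} (hv : Orthonormal ℂ v) (hw : Orthonormal ℂ w) :
    Orthonormal ℂ fun p : ι × κ => tprod (v p.1) (w p.2) := by
  refine ⟨fun p => by rw [norm_tprod, hv.1, hw.1, one_mul], fun p q hpq => ?_⟩
  refine (inner_tprod _ _ _ _).trans (mul_eq_zero.mpr ?_)
  by_contra! hne
  exact hpq (Prod.ext (not_imp_comm.mp (@hv.2 p.1 q.1) hne.1)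
    (not_imp_comm.mp (@hw.2 p.2 q.2) hne.2))

theorem exists_hilbertBasis_tprod (e : HilbertBasis ι ℂ A) (f : HilbertBasis κ ℂ B) :
    ∃ b : HilbertBasis (ι × κ) ℂ (Tensor A B), ∀ p, b p = tprod (e p.1) (f p.2) := by
  have ho := orthonormal_tprod e.orthonormal f.orthonormal
  suffices hspan : (Submodule.span ℂ (Set.range fun p : ι × κ => tprod (e p.1) (f p.2)))ᗮ = ⊥ from
    ⟨.mkOfOrthogonalEqBot ho hspan, fun p => by rw [HilbertBasis.coe_mkOfOrthogonalEqBot]⟩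
  rw [eq_bot_iff]
  intro φ hφ
  have hinner : innerSL ℂ φ = 0 := clm_ext_tprod_hilbertBasis e f fun i j =>
    Submodule.inner_left_of_mem_orthogonal (Submodule.subset_span (Set.mem_range_self (i, j))) hφ
  exact inner_self_eq_zero.mp (congrArg (· φ) hinner)

theorem hasSum_norm_contractLeft_sq (e : HilbertBasis ι ℂ A) (φ : Tensor A B) :
    HasSum (fun i => ‖contractLeft B (e i) φ‖ ^ 2) (‖φ‖ ^ 2) := by
  obtain ⟨b, hb⟩ := exists_hilbertBasis_tprod e (basis B)
  refine (hasSum_norm_inner_sq b φ).prod_fiberwise fun i => ?_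
  simp_rw [hb, ← inner_contractLeft_right]
  exact hasSum_norm_inner_sq (basis B) _

theorem hasSum_norm_contractRight_sq (f : HilbertBasis κ ℂ B) (φ : Tensor A B) :
    HasSum (fun j => ‖contractRight A (f j) φ‖ ^ 2) (‖φ‖ ^ 2) := by
  obtain ⟨b, hb⟩ := exists_hilbertBasis_tprod (basis A) f
  have hsum := (Equiv.prodComm κ (basisIndex A)).hasSum_iff.mpr (hasSum_norm_inner_sq b φ)
  refine hsum.prod_fiberwise fun j => ?_
  simp only [Function.comp_apply, Equiv.prodComm_apply, Prod.swap_prod_mk, hb]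
  simp_rw [← inner_contractRight_right]
  exact hasSum_norm_inner_sq (basis A) _

end Bases

section TensorOp

variable (X : A →L[ℂ] A₁) (Y : B →L[ℂ] B₁)

theorem tensorOp_zero_left : tensorOp (0 : A →L[ℂ] A₁) Y = 0 :=
  clm_ext_tprod fun a b => by
    rw [tensorOp_tprod]
    exact map_zero (tensorRight A₁ (Y b))

theorem tensorOp_add_left (X' : A →L[ℂ] A₁) :
    tensorOp (X + X') Y = tensorOp X Y + tensorOp X' Y :=
  clm_ext_tprod fun a b => by
    simp only [tensorOp_tprod, _root_.add_apply, tprod_add_left]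

theorem tensorOp_smul_left (c : ℂ) : tensorOp (c • X) Y = c • tensorOp X Y :=
  clm_ext_tprod fun a b => by
    simp only [tensorOp_tprod, _root_.smul_apply, tprod_smul_left]

theorem tensorOp_sum_left {ι : Type*} (s : Finset ι) (X : ι → A →L[ℂ] A₁) :
    tensorOp (∑ i ∈ s, X i) Y = ∑ i ∈ s, tensorOp (X i) Y := by
  induction s using Finset.cons_induction with
  | empty => rw [Finset.sum_empty, Finset.sum_empty, tensorOp_zero_left]
  | cons i s hi ih => rw [Finset.sum_cons, Finset.sum_cons, tensorOp_add_left, ih]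

theorem tensorOp_id : tensorOp (.id ℂ A) (.id ℂ B) = .id ℂ (Tensor A B) :=
  clm_ext_tprod fun a b => tensorOp_tprod _ _ a b

theorem tensorOp_comp (X' : A₁ →L[ℂ] A₂) (Y' : B₁ →L[ℂ] B₂) :
    tensorOp X' Y' ∘L tensorOp X Y = tensorOp (X' ∘L X) (Y' ∘L Y) :=
  clm_ext_tprod fun a b => by
    simp only [ContinuousLinearMap.comp_apply, tensorOp_tprod]

theorem tensorOp_rankOne_left (a : A₁) (a' : A) (φ : Tensor A B) :
    tensorOp (InnerProductSpace.rankOne ℂ a a') (.id ℂ B) φ = tprod a (contractLeft B a' φ) := by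
  have hcomp : tensorOp (InnerProductSpace.rankOne ℂ a a') (.id ℂ B) =
      tensorLeft B a ∘L contractLeft B a' := clm_ext_tprod fun c b => by
    rw [tensorOp_tprod, ContinuousLinearMap.comp_apply, contractLeft_tprod, tensorLeft_apply,
      tprod_smul_right, InnerProductSpace.rankOne_apply, tprod_smul_left]
    rfl
  exact congrArg (· φ) hcomp

theorem contractLeft_tensorOp_id_left (a : A) (φ : Tensor A B) :
    contractLeft B₁ a (tensorOp (.id ℂ A) Y φ) = Y (contractLeft B a φ) := by
  have hcomp : contractLeft B₁ a ∘L tensorOp (.id ℂ A) Y = Y ∘L contractLeft B a :=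
    clm_ext_tprod fun c b => by
      simp only [ContinuousLinearMap.comp_apply, tensorOp_tprod, contractLeft_tprod, map_smul]
      rfl
  exact congrArg (· φ) hcomp

theorem contractRight_tensorOp_id_right (b : B) (φ : Tensor A B) :
    contractRight A₁ b (tensorOp X (.id ℂ B) φ) = X (contractRight A b φ) := by
  have hcomp : contractRight A₁ b ∘L tensorOp X (.id ℂ B) = X ∘L contractRight A b :=
    clm_ext_tprod fun c b => by
      simp only [ContinuousLinearMap.comp_apply, tensorOp_tprod, contractRight_tprod, map_smul]
      rfl
  exact congrArg (· φ) hcomp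

end TensorOp

section Completeness

variable {ι : Type*}

theorem hasSum_norm_tensorOp_id_right_sq {X : ι → A →L[ℂ] A₁}
    (hX : ∀ a, HasSum (fun i => ‖X i a‖ ^ 2) (‖a‖ ^ 2)) (φ : Tensor A B) :
    HasSum (fun i => ‖tensorOp (X i) (.id ℂ B) φ‖ ^ 2) (‖φ‖ ^ 2) := by
  refine hasSum_comm_of_nonneg (fun _ _ => by positivity)
    (fun j => hX (contractRight A (basis B j) φ)) (hasSum_norm_contractRight_sq (basis B) φ)
    fun i => ?_
  simp_rw [← contractRight_tensorOp_id_right]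
  exact hasSum_norm_contractRight_sq (basis B) _

theorem hasSum_norm_tensorOp_id_left_sq {Y : ι → B →L[ℂ] B₁}
    (hY : ∀ b, HasSum (fun i => ‖Y i b‖ ^ 2) (‖b‖ ^ 2)) (φ : Tensor A B) :
    HasSum (fun i => ‖tensorOp (.id ℂ A) (Y i) φ‖ ^ 2) (‖φ‖ ^ 2) := by
  refine hasSum_comm_of_nonneg (fun _ _ => by positivity)
    (fun j => hY (contractLeft B (basis A j) φ)) (hasSum_norm_contractLeft_sq (basis A) φ)
    fun i => ?_
  simp_rw [← contractLeft_tensorOp_id_left]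
  exact hasSum_norm_contractLeft_sq (basis A) _

end Completeness

end Tensor

section SpectralTheorem

variable {𝕜 : Type v} {H : Type u} [RCLike 𝕜] [NormedAddCommGroup H] [InnerProductSpace 𝕜 H]
  [CompleteSpace H]

theorem exists_hilbertBasis_of_orthogonalFamily {κ : Type v} {V : κ → Submodule 𝕜 H}
    [∀ k, CompleteSpace (V k)] (hV : OrthogonalFamily 𝕜 (fun k => V k) fun k => (V k).subtypeₗᵢ)
    (hbot : (⨆ k, V k)ᗮ = ⊥) :
    ∃ (ι : Type (max u v)) (e : HilbertBasis ι 𝕜 H), ∀ i, ∃ k, e i ∈ V k := by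
  choose w b _ using fun k => exists_hilbertBasis 𝕜 (V k)
  have ho : Orthonormal 𝕜 fun i : Σ k, w k => (b i.1 i.2 : H) :=
    hV.orthonormal_sigma_orthonormal fun k => (b k).orthonormal
  suffices hspan : (Submodule.span 𝕜 (Set.range fun i : Σ k, w k => (b i.1 i.2 : H)))ᗮ = ⊥ from
    ⟨_, .mkOfOrthogonalEqBot ho hspan, fun i =>
      ⟨i.1, by rw [HilbertBasis.coe_mkOfOrthogonalEqBot]; exact (b i.1 i.2).2⟩⟩
  rw [eq_bot_iff, ← hbot, ← Submodule.iInf_orthogonal]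
  refine fun v hv => Submodule.mem_iInf _ |>.mpr fun k => ?_
  have hzero : innerSL 𝕜 v ∘L (V k).subtypeL = 0 := clm_ext_hilbertBasis (b k) fun j =>
    Submodule.inner_left_of_mem_orthogonal
      (Submodule.subset_span (Set.mem_range_self (⟨k, j⟩ : Σ k, w k))) hv
  exact (Submodule.mem_orthogonal' _ _).mpr fun y hy => congrArg (· ⟨y, hy⟩) hzero

theorem exists_hilbertBasis_eigenvectors {T : H →L[𝕜] H} (hc : IsCompactOperator T)
    (hT : IsSelfAdjoint T) :
    ∃ (ι : Type (max u v)) (e : HilbertBasis ι 𝕜 H) (p : ι → ℝ),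
      ∀ i, T (e i) = (p i : 𝕜) • e i := by
  have hs := hT.isSymmetric
  have hcomplete : ∀ μ : 𝕜, CompleteSpace (Module.End.eigenspace (T : Module.End 𝕜 H) μ) :=
    fun μ => by
      rw [Module.End.eigenspace_def]
      exact (T - algebraMap 𝕜 (H →L[𝕜] H) μ).isClosed_ker.completeSpace_coe
  obtain ⟨ι, e, he⟩ := exists_hilbertBasis_of_orthogonalFamily hs.orthogonalFamily_eigenspaces
    (ContinuousLinearMap.orthogonalComplement_iSup_eigenspaces_eq_bot hc hs)
  choose μ hμ using he
  refine ⟨ι, e, fun i => RCLike.re (μ i), fun i => ?_⟩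
  have hreal := hs.conj_eigenvalue_eq_self
    (Module.End.hasEigenvalue_of_hasEigenvector ⟨hμ i, e.orthonormal.ne_zero i⟩)
  rw [RCLike.conj_eq_iff_re.mp hreal]
  exact Module.End.mem_eigenspace_iff.mp (hμ i)

end SpectralTheorem
section Diagonal

variable {𝕜 H ι : Type*} [RCLike 𝕜] [NormedAddCommGroup H] [InnerProductSpace 𝕜 H]
  [CompleteSpace H] {T : H →L[𝕜] H} {e : HilbertBasis ι 𝕜 H} {p : ι → ℝ}

theorem norm_le_of_apply_basis_eq_smul (hT : IsSelfAdjoint T)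
    (he : ∀ i, T (e i) = (p i : 𝕜) • e i) {m : ℝ} (hm : 0 ≤ m) (hp : ∀ i, |p i| ≤ m) :
    ‖T‖ ≤ m := by
  refine ContinuousLinearMap.opNorm_le_bound _ hm fun a => ?_
  refine (pow_le_pow_iff_left₀ (norm_nonneg _) (by positivity) two_ne_zero).mp ?_
  rw [mul_pow]
  refine hasSum_le (fun i => ?_) (hasSum_norm_inner_sq e (T a))
    ((hasSum_norm_inner_sq e a).mul_left (m ^ 2))
  rw [← ContinuousLinearMap.adjoint_inner_left, hT.adjoint_eq, he, inner_smul_left, norm_mul,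
    mul_pow, RCLike.norm_conj, RCLike.norm_ofReal]
  gcongr
  exact hp i

theorem exists_forall_le_of_summable {q : ι → ℝ} (hs : Summable q) {k : ι} (hk : 0 < q k) :
    ∃ i, ∀ j, q j ≤ q i := by
  have hfin : {j | q k ≤ q j}.Finite := by
    simpa only [Filter.eventually_cofinite, not_lt] using
      hs.tendsto_cofinite_zero.eventually (gt_mem_nhds hk)
  obtain ⟨i, hi, hmax⟩ := hfin.toFinset.exists_max_image q ⟨k, by simp⟩
  refine ⟨i, fun j => (le_total (q k) (q j)).elim (fun hj => hmax j (by simpa using hj)) ?_⟩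
  exact fun hj => hj.trans (by simpa using hi)

theorem exists_le_eigenvalue (hT : IsSelfAdjoint T) (he : ∀ i, T (e i) = (p i : 𝕜) • e i)
    (hp : ∀ i, 0 ≤ p i) (hs : Summable p) {x : ℝ} (hx : 0 < x) (hxT : x ≤ ‖T‖) :
    ∃ i, x ≤ p i := by
  obtain ⟨k, hk⟩ : ∃ k, 0 < p k := by
    by_contra! hnonpos
    have hTle := norm_le_of_apply_basis_eq_smul hT he le_rfl fun i =>
      (abs_of_nonneg (hp i)).trans_le (hnonpos i)
    exact hx.not_ge (hxT.trans hTle)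
  obtain ⟨i, hi⟩ := exists_forall_le_of_summable hs hk
  exact ⟨i, hxT.trans <| norm_le_of_apply_basis_eq_smul hT he (hp i) fun j =>
    (abs_of_nonneg (hp j)).trans_le (hi j)⟩

end Diagonal

section FunctionalCalculus

variable {H ι : Type*} [NormedAddCommGroup H] [InnerProductSpace ℂ H] {T : H →L[ℂ] H}

theorem mem_spectrum_of_apply_eq_smul {v : H} (hv : v ≠ 0) {μ : ℝ} (hTv : T v = (μ : ℂ) • v) :
    μ ∈ spectrum ℝ T := by
  rw [spectrum.mem_iff]
  intro hunit
  obtain ⟨S, hS⟩ := hunit.exists_left_inv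
  have hker : (algebraMap ℝ (H →L[ℂ] H) μ - T) v = 0 := by
    rw [sub_apply, hTv, Algebra.algebraMap_eq_smul_one]
    simp
  have hSv : S ((algebraMap ℝ (H →L[ℂ] H) μ - T) v) = v := congrArg (· v) hS
  rw [hker, map_zero] at hSv
  exact hv hSv.symm

variable [CompleteSpace H]

theorem cfc_apply_of_apply_eq_smul (hT : IsSelfAdjoint T) {f : ℝ → ℝ}
    (hf : ContinuousOn f (spectrum ℝ T)) {v : H} {μ : ℝ} (hTv : T v = (μ : ℂ) • v) :
    cfc f T v = (f μ : ℂ) • v := by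
  rcases eq_or_ne v 0 with rfl | hv
  · simp only [map_zero, smul_zero]
  have hμ := mem_spectrum_of_apply_eq_smul hv hTv
  suffices hhom : ∀ g : C(spectrum ℝ T, ℝ), cfcHom hT g v = (g ⟨μ, hμ⟩ : ℂ) • v by
    rw [cfc_apply f T hT hf, hhom]
    rfl
  intro g
  open scoped ContinuousFunctionalCalculus in
  induction g using ContinuousMap.induction_on_of_compact with
  | const r =>
    have hconst : cfcHom hT (ContinuousMap.const _ r) = algebraMap ℝ (H →L[ℂ] H) r :=
      AlgHomClass.commutes (cfcHom hT) r
    rw [hconst, Algebra.algebraMap_eq_smul_one]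
    simp
  | id => rw [cfcHom_id hT]; exact hTv
  | star_id => rw [map_star, cfcHom_id, hT.star_eq]; exact hTv
  | add f g hf hg => rw [map_add, add_apply, hf, hg]; simp [add_smul]
  | mul f g hf hg =>
    rw [map_mul, ContinuousLinearMap.mul_def, ContinuousLinearMap.comp_apply, hg, map_smul, hf,
      smul_smul, ContinuousMap.mul_apply, Complex.ofReal_mul, mul_comm]
  | frequently g hg =>
    have hclosed : IsClosed {g : C(spectrum ℝ T, ℝ) | cfcHom hT g v = (g ⟨μ, hμ⟩ : ℂ) • v} :=
      isClosed_eq ((ContinuousLinearMap.apply ℂ H v).continuous.comp (cfcHom_continuous hT))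
        ((Complex.continuous_ofReal.comp (continuous_eval_const _)).smul continuous_const)
    exact hclosed.closure_subset_iff.mpr subset_rfl (mem_closure_iff_frequently.mpr hg)

theorem trace_eq_of_apply_basis_eq_smul {e : HilbertBasis ι ℂ H} {a : ι → ℝ} {t : ℝ}
    (hTe : ∀ i, T (e i) = (a i : ℂ) • e i) (ha : ∀ i, 0 ≤ a i) (ht : HasSum a t) :
    trace T = t := by
  set v : ι → H := fun i => ((√(a i) : ℝ) : ℂ) • e i with hv
  have hnorm : ∀ i, ‖((√(a i) : ℝ) : ℂ)‖ ^ 2 = a i := fun i => by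
    rw [Complex.norm_real, Real.norm_eq_abs, sq_abs, Real.sq_sqrt (ha i)]
  have hvsum : HasSum (fun i => ‖v i‖ ^ 2) t := by
    simpa only [hv, norm_smul, e.orthonormal.1, mul_one, hnorm] using ht
  have hpure := (summable_pureState hvsum.summable).hasSum
  suffices hT : T = ∑' i, pureState (v i) from trace_of_hasSum_pureState hvsum (hT ▸ hpure)
  refine clm_ext_hilbertBasis e fun k => ?_
  refine HasSum.unique ?_ (hpure.mapL (.apply ℂ H (e k)))
  have hdiag : T (e k) = pureState (v k) (e k) := by
    rw [hTe, hv, pureState_smul, hnorm, smul_apply, pureState_apply, inner_self_eq_norm_sq_to_K,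
      e.orthonormal.1]
    simp
  rw [hdiag]
  refine hasSum_single k fun i hik => ?_
  simp only [hv, pureState_smul, ContinuousLinearMap.apply_apply, smul_apply, pureState_apply,
    e.orthonormal.2 hik, zero_smul, smul_zero]

theorem h_eq_of_apply_basis_eq_smul {A : QSystem.{u}} {ρ : A →L[ℂ] A} {e : HilbertBasis ι ℂ A}
    {p : ι → ℝ} (hρ : IsSelfAdjoint ρ) (he : ∀ i, ρ (e i) = (p i : ℂ) • e i) {x t : ℝ}
    (ht : HasSum (fun i => max (p i - x) 0) t) : h ρ x = t := by
  have hfun : (fun t : ℝ => (t - x) * Set.indicator {s : ℝ | 0 ≤ s - x} 1 t) =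
      fun t => max (t - x) 0 := by
    ext s
    by_cases hs : 0 ≤ s - x
    · rw [Set.indicator_of_mem (by exact hs), max_eq_left hs, Pi.one_apply, mul_one]
    · rw [Set.indicator_of_notMem (by exact hs), max_eq_right (not_le.mp hs).le, mul_zero]
  have hdiag : ∀ i, cfc (fun t : ℝ => max (t - x) 0) ρ (e i) =
      ((max (p i - x) 0 : ℝ) : ℂ) • e i := fun i =>
    cfc_apply_of_apply_eq_smul hρ (by fun_prop) (he i)
  rw [h, hfun, trace_eq_of_apply_basis_eq_smul hdiag (fun _ => le_max_right _ _) ht,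
    Complex.ofReal_re]

end FunctionalCalculus

section ReducedDensity

variable {A : QSystem.{u}} {B : QSystem.{v}}

theorem hasSum_reducedDensity (φ : Tensor A B) :
    HasSum (fun j => pureState (contractRight A (basis B j) φ)) (reducedDensity φ) := by
  have hs := summable_pureState (hasSum_norm_contractRight_sq (basis B) φ).summable
  convert! hs.hasSum using 1
  refine tsum_congr fun j => ?_
  rw [contractRight, ← comp_pureState_comp_adjoint, ContinuousLinearMap.adjoint_adjoint]

theorem inner_reducedDensity (φ : Tensor A B) (a a' : A) :
    ⟪a, reducedDensity φ a'⟫_ℂ = ⟪contractLeft B a' φ, contractLeft B a φ⟫_ℂ := by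
  refine (((hasSum_reducedDensity φ).mapL (.apply ℂ A a')).mapL (innerSL ℂ a)).unique ?_
  convert! (basis B).hasSum_inner_mul_inner (contractLeft B a' φ) (contractLeft B a φ) using 2
    with j
  rw [ContinuousLinearMap.apply_apply, pureState_apply, innerSL_apply_apply, inner_smul_right,
    inner_contractRight_right, inner_contractLeft_right, ← inner_conj_symm (contractLeft B a' φ),
    inner_contractLeft_right, ← inner_contractRight_right a', inner_conj_symm]

theorem norm_contractLeft_sq (φ : Tensor A B) (a : A) :
    ((‖contractLeft B a φ‖ ^ 2 : ℝ) : ℂ) = ⟪a, reducedDensity φ a⟫_ℂ := by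
  rw [inner_reducedDensity, inner_self_eq_norm_sq_to_K]
  norm_cast

theorem isSelfAdjoint_reducedDensity (φ : Tensor A B) : IsSelfAdjoint (reducedDensity φ) := by
  refine ContinuousLinearMap.isSelfAdjoint_iff_isSymmetric.mpr fun a a' => ?_
  simp only [ContinuousLinearMap.coe_coe]
  rw [inner_reducedDensity, ← inner_conj_symm, inner_reducedDensity, inner_conj_symm]

theorem norm_contractLeft_sq_le (φ : Tensor A B) (a : A) :
    ‖contractLeft B a φ‖ ^ 2 ≤ ‖reducedDensity φ‖ * ‖a‖ ^ 2 := by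
  have hnorm := congrArg norm (norm_contractLeft_sq φ a)
  rw [Complex.norm_real, Real.norm_of_nonneg (by positivity)] at hnorm
  calc ‖contractLeft B a φ‖ ^ 2 ≤ ‖a‖ * ‖reducedDensity φ a‖ :=
        hnorm.trans_le (norm_inner_le_norm _ _)
    _ ≤ ‖a‖ * (‖reducedDensity φ‖ * ‖a‖) := by gcongr; exact (reducedDensity φ).le_opNorm a
    _ = ‖reducedDensity φ‖ * ‖a‖ ^ 2 := by ring

theorem reducedDensity_smul (c : ℂ) (φ : Tensor A B) :
    reducedDensity (c • φ) = ((‖c‖ ^ 2 : ℝ) : ℂ) • reducedDensity φ := by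
  ext a
  refine ext_inner_left ℂ fun a' => ?_
  rw [inner_reducedDensity, map_smul, map_smul, inner_smul_left, inner_smul_right, smul_apply,
    inner_smul_right, inner_reducedDensity, ← mul_assoc, Complex.conj_mul']
  norm_cast

end ReducedDensity

section Schmidt

variable {A : QSystem.{u}} {B : QSystem.{v}}

/-- The Schmidt decomposition `φ = ∑ i, e i ⊗ contractLeft B (e i) φ` of a vector `φ`, encoded by a
Hilbert basis `e` of eigenvectors of the reduced density of `φ`; the Schmidt coefficients are the
square roots of the eigenvalues `weight i`. -/
structure SchmidtDecomposition (φ : Tensor A B) where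
  Index : Type u
  basis : HilbertBasis Index ℂ A
  weight : Index → ℝ
  reducedDensity_basis : ∀ i, reducedDensity φ (basis i) = (weight i : ℂ) • basis i

theorem nonempty_schmidtDecomposition (φ : Tensor A B) : Nonempty (SchmidtDecomposition φ) := by
  obtain ⟨ι, e, p, he⟩ := exists_hilbertBasis_eigenvectors
    (isCompactOperator_of_hasSum_pureState (hasSum_reducedDensity φ))
    (isSelfAdjoint_reducedDensity φ)
  exact ⟨⟨ι, e, p, he⟩⟩

namespace SchmidtDecomposition

variable {φ : Tensor A B} (D : SchmidtDecomposition φ)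

theorem countable_index : Countable D.Index :=
  countable_of_orthonormal D.basis.orthonormal

theorem inner_contractLeft (i j : D.Index) :
    ⟪contractLeft B (D.basis i) φ, contractLeft B (D.basis j) φ⟫_ℂ =
      D.weight i * ⟪D.basis j, D.basis i⟫_ℂ := by
  rw [← inner_reducedDensity, D.reducedDensity_basis, inner_smul_right]

theorem norm_contractLeft_sq (i : D.Index) :
    ‖contractLeft B (D.basis i) φ‖ ^ 2 = D.weight i := by
  have hinner := D.inner_contractLeft i i
  rw [inner_self_eq_norm_sq_to_K, inner_self_eq_norm_sq_to_K, D.basis.orthonormal.1] at hinner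
  simpa [← Complex.ofReal_pow] using hinner

theorem weight_nonneg (i : D.Index) : 0 ≤ D.weight i := by
  rw [← D.norm_contractLeft_sq]
  positivity

theorem hasSum_weight : HasSum D.weight (‖φ‖ ^ 2) :=
  (hasSum_norm_contractLeft_sq D.basis φ).congr_fun fun i => (D.norm_contractLeft_sq i).symm

theorem hasSum_max_weight_sub {x : ℝ} (hx : 0 ≤ x) :
    HasSum (fun i => max (D.weight i - x) 0) (h (reducedDensity φ) x) := by
  have hs : Summable fun i => max (D.weight i - x) 0 :=
    D.hasSum_weight.summable.of_nonneg_of_le (fun _ => le_max_right _ _) fun i =>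
      max_le (sub_le_self _ hx) (D.weight_nonneg i)
  rw [h_eq_of_apply_basis_eq_smul (isSelfAdjoint_reducedDensity φ) D.reducedDensity_basis hs.hasSum]
  exact hs.hasSum

theorem hasSum_min_weight {x : ℝ} (hx : 0 ≤ x) :
    HasSum (fun i => min (D.weight i) x) (‖φ‖ ^ 2 - h (reducedDensity φ) x) :=
  (D.hasSum_weight.sub (D.hasSum_max_weight_sub hx)).congr_fun fun i => by
    rw [← sub_zero (D.weight i), ← sub_self (D.weight i)]
    rcases le_total (D.weight i) x with hi | hi <;> simp [hi]

theorem exists_le_weight {x : ℝ} (hx : 0 < x) (hxφ : x ≤ ‖reducedDensity φ‖) :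
    ∃ i, x ≤ D.weight i :=
  exists_le_eigenvalue (isSelfAdjoint_reducedDensity φ) D.reducedDensity_basis D.weight_nonneg
    D.hasSum_weight.summable hx hxφ

/-- The indices of the nonzero Schmidt coefficients. -/
abbrev Support : Type u := {i : D.Index // 0 < D.weight i}

/-- The right Schmidt vectors: the normalized `⟨e i| ⊗ 1` images of `φ`. -/
def rightVector (i : D.Support) : B :=
  ((√(D.weight i))⁻¹ : ℂ) • contractLeft B (D.basis i) φ

theorem orthonormal_rightVector : Orthonormal ℂ D.rightVector := by
  refine ⟨fun i => ?_, fun i j hij => ?_⟩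
  · have hnorm : ‖contractLeft B (D.basis i) φ‖ = √(D.weight i) := by
      rw [← D.norm_contractLeft_sq, Real.sqrt_sq (norm_nonneg _)]
    rw [rightVector, norm_smul, hnorm, norm_inv, Complex.norm_real, Real.norm_eq_abs,
      abs_of_nonneg (Real.sqrt_nonneg _), inv_mul_cancel₀ (Real.sqrt_pos.mpr i.2).ne']
  · change ⟪D.rightVector i, D.rightVector j⟫_ℂ = 0
    rw [rightVector, rightVector, inner_smul_left, inner_smul_right, D.inner_contractLeft,
      D.basis.orthonormal.2 (Subtype.coe_ne_coe.mpr hij.symm)]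
    simp only [mul_zero]

end SchmidtDecomposition

theorem le_norm_sq_sub_h {φ : Tensor A B} {x : ℝ} (hx : 0 < x) (hxφ : x ≤ ‖reducedDensity φ‖) :
    x ≤ ‖φ‖ ^ 2 - h (reducedDensity φ) x := by
  obtain ⟨D⟩ := nonempty_schmidtDecomposition φ
  obtain ⟨i, hi⟩ := D.exists_le_weight hx hxφ
  calc x = min (D.weight i) x := (min_eq_right hi).symm
    _ ≤ _ := le_hasSum (D.hasSum_min_weight hx.le) i fun j _ => le_min (D.weight_nonneg j) hx.le

end Schmidt

theorem hasSum_sigma_of_nonneg {κ : Type*} {γ : κ → Type*} {f : (Σ j, γ j) → ℝ} {r : κ → ℝ} {a : ℝ}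
    (hf : ∀ w, 0 ≤ f w) (hr : ∀ j, HasSum (fun c => f ⟨j, c⟩) (r j)) (ha : HasSum r a) :
    HasSum f a := by
  refine ha.sigma_of_hasSum hr ((summable_sigma_of_nonneg hf).mpr ⟨fun j => (hr j).summable, ?_⟩)
  exact ha.summable.congr fun j => (hr j).tsum_eq.symm

theorem summable_of_summable_finsetSum_of_nonneg {ι κ : Type*} {f : ι → κ → ℝ} {s : Finset ι}
    (hf : ∀ i w, 0 ≤ f i w) (hs : Summable fun w => ∑ i ∈ s, f i w) {i : ι} (hi : i ∈ s) :
    Summable (f i) :=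
  hs.of_nonneg_of_le (hf i) fun w =>
    Finset.single_le_sum (f := fun i => f i w) (fun i _ => hf i w) hi

section Protocols

variable {A A₁ A' : QSystem.{u}} {B B₁ B' : QSystem.{v}}

/-- A representation of a two-valued instrument by countably many product operators, as for the
instrument of an LOCC protocol: `History` is the set of sequences of outcomes, and `kraus i w` is
the composition of the measurement operators along the history `w` if the value reported after `w`
is `i`, and `0` otherwise. Only the action on pure states is recorded. -/
structure KrausRepresentation (I : Fin 2 → Op A B → Op A' B') where
  History : Type
  kraus : Fin 2 → History → Tensor A B →L[ℂ] Tensor A' B'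
  exists_kraus_eq_tensorOp : ∀ i w, ∃ (X : A →L[ℂ] A') (Y : B →L[ℂ] B'), kraus i w = tensorOp X Y
  hasSum_sum_norm_sq : ∀ φ, HasSum (fun w => ∑ i, ‖kraus i w φ‖ ^ 2) (‖φ‖ ^ 2)
  hasSum_pureState : ∀ i φ, HasSum (fun w => pureState (kraus i w φ)) (I i (pureState φ))

namespace KrausRepresentation

theorem summable_norm_sq {I : Fin 2 → Op A B → Op A' B'} (D : KrausRepresentation I) (i : Fin 2)
    (φ : Tensor A B) : Summable fun w => ‖D.kraus i w φ‖ ^ 2 :=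
  summable_of_summable_finsetSum_of_nonneg (f := fun i w => ‖D.kraus i w φ‖ ^ 2)
    (fun _ _ => sq_nonneg _) (D.hasSum_sum_norm_sq φ).summable (Finset.mem_univ i)

/-- The representation of the instrument which reports `value` and does nothing. -/
def finish (value : Fin 2) :
    KrausRepresentation fun i (T : Op A B) => if i = value then T else 0 where
  History := Unit
  kraus i _ := if i = value then .id ℂ (Tensor A B) else 0
  exists_kraus_eq_tensorOp i _ := by
    by_cases hi : i = value
    · exact ⟨.id ℂ A, .id ℂ B, by rw [if_pos hi, tensorOp_id]⟩
    · exact ⟨0, 0, by rw [if_neg hi, tensorOp_zero_left]⟩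
  hasSum_sum_norm_sq φ := by
    have hsum : ∑ i, ‖(if i = value then ContinuousLinearMap.id ℂ (Tensor A B) else 0) φ‖ ^ 2 =
        ‖φ‖ ^ 2 := by
      fin_cases value <;> simp
    exact hsum ▸ hasSum_unique fun _ : Unit => _
  hasSum_pureState i φ := by
    have hpure : pureState ((if i = value then ContinuousLinearMap.id ℂ (Tensor A B) else 0) φ) =
        if i = value then pureState φ else 0 := by
      by_cases hi : i = value <;> simp [hi, pureState]
    exact hpure ▸ hasSum_unique fun _ : Unit => _

/-- The representation of a measurement with operators `X j`, followed by instruments which may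
depend on the outcome `j`. -/
def round {J : ℕ → Fin 2 → Op A₁ B₁ → Op A' B'} (D : ∀ j, KrausRepresentation (J j))
    {X : ℕ → Tensor A B →L[ℂ] Tensor A₁ B₁}
    (hX : ∀ φ, HasSum (fun j => ‖X j φ‖ ^ 2) (‖φ‖ ^ 2))
    (hprod : ∀ j, ∃ (Y : A →L[ℂ] A₁) (Z : B →L[ℂ] B₁), X j = tensorOp Y Z) :
    KrausRepresentation fun i T =>
      ∑' j, J j i ((X j ∘L T) ∘L ContinuousLinearMap.adjoint (X j)) :=
  have hnorm : ∀ φ, HasSum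
      (fun w : Σ j, (D j).History => ∑ i, ‖((D w.1).kraus i w.2 ∘L X w.1) φ‖ ^ 2) (‖φ‖ ^ 2) :=
    fun φ => hasSum_sigma_of_nonneg (fun _ => Finset.sum_nonneg fun _ _ => sq_nonneg _)
      (fun j => (D j).hasSum_sum_norm_sq (X j φ)) (hX φ)
  { History := Σ j, (D j).History
    kraus := fun i w => (D w.1).kraus i w.2 ∘L X w.1
    exists_kraus_eq_tensorOp := fun i w => by
      obtain ⟨Y, Z, hYZ⟩ := hprod w.1
      obtain ⟨Y', Z', hYZ'⟩ := (D w.1).exists_kraus_eq_tensorOp i w.2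
      exact ⟨Y' ∘L Y, Z' ∘L Z, by rw [hYZ, hYZ', tensorOp_comp]⟩
    hasSum_sum_norm_sq := hnorm
    hasSum_pureState := fun i φ => by
      have hs := summable_of_summable_finsetSum_of_nonneg
        (f := fun i (w : Σ j, (D j).History) => ‖((D w.1).kraus i w.2 ∘L X w.1) φ‖ ^ 2)
        (fun _ _ => sq_nonneg _) (hnorm φ).summable (Finset.mem_univ i)
      have hp := (summable_pureState hs).hasSum
      simp only [comp_pureState_comp_adjoint]
      rwa [← (hp.sigma fun j => (D j).hasSum_pureState i (X j φ)).tsum_eq] at hp }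

end KrausRepresentation

namespace LOCC

variable {n : ℕ} (P : LOCC A' B' n A B)

theorem nonempty_krausRepresentation : Nonempty (KrausRepresentation P.instrument) := by
  induction P with
  | finish value => exact ⟨.finish value⟩
  | alice A₁ M next ih =>
    exact ⟨.round (fun j => (ih j).some) (hasSum_norm_tensorOp_id_right_sq M.complete)
      fun j => ⟨M.K j, _, rfl⟩⟩
  | bob B₁ M next ih =>
    exact ⟨.round (fun j => (ih j).some) (hasSum_norm_tensorOp_id_left_sq M.complete)
      fun j => ⟨_, M.K j, rfl⟩⟩

theorem sum_trace_instrument_pureState (φ : Tensor A B) :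
    ∑ i, trace (P.instrument i (pureState φ)) = ((‖φ‖ ^ 2 : ℝ) : ℂ) := by
  obtain ⟨D⟩ := P.nonempty_krausRepresentation
  simp only [fun i =>
    trace_of_hasSum_pureState (D.summable_norm_sq i φ).hasSum (D.hasSum_pureState i φ)]
  rw [← Complex.ofReal_sum, ← Summable.tsum_finsetSum fun i _ => D.summable_norm_sq i φ,
    (D.hasSum_sum_norm_sq φ).tsum_eq]

end LOCC

end Protocols

section SchmidtRank

variable {A A₁ : QSystem.{u}} {B B₁ : QSystem.{v}}

theorem norm_sub_sum_tprod_contractLeft_sq {ι : Type*} {v : ι → A} (hv : Orthonormal ℂ v)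
    (s : Finset ι) (φ : Tensor A B) :
    ‖φ - ∑ i ∈ s, tprod (v i) (contractLeft B (v i) φ)‖ ^ 2 =
      ‖φ‖ ^ 2 - ∑ i ∈ s, ‖contractLeft B (v i) φ‖ ^ 2 := by
  classical
  set χ := ∑ i ∈ s, tprod (v i) (contractLeft B (v i) φ) with hχ
  have hinner (ψ : Tensor A B) :
      ⟪χ, ψ⟫_ℂ = ∑ i ∈ s, ⟪contractLeft B (v i) φ, contractLeft B (v i) ψ⟫_ℂ := by
    rw [hχ, sum_inner]
    exact Finset.sum_congr rfl fun i _ => (inner_contractLeft_right _ _ _).symm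
  have hcontract : ∀ i ∈ s, contractLeft B (v i) χ = contractLeft B (v i) φ := fun i hi => by
    simp only [hχ, map_sum, contractLeft_tprod, orthonormal_iff_ite.mp hv, ite_smul, one_smul,
      zero_smul, Finset.sum_ite_eq, if_pos hi]
  have hφχ : ⟪χ, φ⟫_ℂ = ((∑ i ∈ s, ‖contractLeft B (v i) φ‖ ^ 2 : ℝ) : ℂ) := by
    rw [hinner]
    push_cast
    exact Finset.sum_congr rfl fun i _ => inner_self_eq_norm_sq_to_K _
  have hχχ : ⟪χ, χ⟫_ℂ = ⟪χ, φ⟫_ℂ := by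
    rw [hinner, hinner]
    exact Finset.sum_congr rfl fun i hi => by rw [hcontract i hi]
  have hnorm : ‖χ‖ ^ 2 = ∑ i ∈ s, ‖contractLeft B (v i) φ‖ ^ 2 := by
    rw [← inner_self_eq_norm_sq (𝕜 := ℂ), hχχ, hφχ, RCLike.re_eq_complex_re, Complex.ofReal_re]
  rw [norm_sub_rev, @norm_sub_sq ℂ, hφχ, hnorm, RCLike.re_eq_complex_re, Complex.ofReal_re]
  ring

/-- The vector `φ` has Schmidt rank at most `k`, that is, it is a sum of `k` elementary tensors. -/
def SchmidtRankLE (k : ℕ) (φ : Tensor A B) : Prop :=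
  ∃ (a : Fin k → A) (b : Fin k → B), φ = ∑ i, tprod (a i) (b i)

theorem schmidtRankLE_sum {ι : Type*} (s : Finset ι) (a : ι → A) (b : ι → B) :
    SchmidtRankLE s.card (∑ i ∈ s, tprod (a i) (b i)) := by
  refine ⟨fun l => a (s.equivFin.symm l), fun l => b (s.equivFin.symm l), ?_⟩
  rw [← Finset.sum_coe_sort s fun i => tprod (a i) (b i)]
  exact (Equiv.sum_comp s.equivFin.symm fun i : s => tprod (a i) (b i)).symm

namespace SchmidtRankLE

variable {k : ℕ} {χ : Tensor A B}

theorem tensorOp (hχ : SchmidtRankLE k χ) (X : A →L[ℂ] A₁) (Y : B →L[ℂ] B₁) :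
    SchmidtRankLE k (tensorOp X Y χ) := by
  obtain ⟨a, b, rfl⟩ := hχ
  exact ⟨fun i => X (a i), fun i => Y (b i), by simp only [map_sum, tensorOp_tprod]⟩

theorem exists_orthonormal (hχ : SchmidtRankLE k χ) :
    ∃ m ≤ k, ∃ v : Fin m → A, Orthonormal ℂ v ∧
      ∑ l, tprod (v l) (contractLeft B (v l) χ) = χ := by
  obtain ⟨a, b, rfl⟩ := hχ
  let V := Submodule.span ℂ (Set.range a)
  have : FiniteDimensional ℂ V := .span_of_finite ℂ (Set.finite_range a)
  let o := stdOrthonormalBasis ℂ V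
  have hrank : Module.finrank ℂ V ≤ k :=
    (finrank_range_le_card (R := ℂ) a).trans_eq (Fintype.card_fin k)
  refine ⟨_, hrank, fun l => o l, o.orthonormal.comp_linearIsometry V.subtypeₗᵢ, ?_⟩
  have hexpand (i : Fin k) : ∑ l, ⟪(o l : A), a i⟫_ℂ • (o l : A) = a i := by
    simpa using congrArg Subtype.val (o.sum_repr' ⟨a i, Submodule.subset_span ⟨i, rfl⟩⟩)
  simp only [map_sum, contractLeft_tprod]
  simp only [← tensorLeft_apply, map_sum]
  rw [Finset.sum_comm]
  refine Finset.sum_congr rfl fun i _ => ?_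
  conv_rhs => rw [← hexpand i, tensorLeft_apply, ← tensorRight_apply, map_sum]
  simp only [tensorLeft_apply, tensorRight_apply, tprod_smul_left, tprod_smul_right]

theorem norm_sq_sub_le_norm_sub_sq (hχ : SchmidtRankLE k χ) (φ : Tensor A B) :
    ‖φ‖ ^ 2 - k * ‖reducedDensity φ‖ ≤ ‖φ - χ‖ ^ 2 := by
  obtain ⟨m, hm, v, hv, hvχ⟩ := hχ.exists_orthonormal
  have hdiff : φ - χ - ∑ l, tprod (v l) (contractLeft B (v l) (φ - χ)) =
      φ - ∑ l, tprod (v l) (contractLeft B (v l) φ) := by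
    simp only [map_sub, ← tensorLeft_apply (B := B), Finset.sum_sub_distrib] at hvχ ⊢
    rw [hvχ]
    abel
  have hsum : ∑ l, ‖contractLeft B (v l) φ‖ ^ 2 ≤ k * ‖reducedDensity φ‖ :=
    calc ∑ l, ‖contractLeft B (v l) φ‖ ^ 2 ≤ ∑ _l : Fin m, ‖reducedDensity φ‖ :=
          Finset.sum_le_sum fun l _ => by simpa [hv.1 l] using norm_contractLeft_sq_le φ (v l)
      _ = m * ‖reducedDensity φ‖ := by simp
      _ ≤ k * ‖reducedDensity φ‖ := by gcongr
  calc ‖φ‖ ^ 2 - k * ‖reducedDensity φ‖ ≤ ‖φ‖ ^ 2 - ∑ l, ‖contractLeft B (v l) φ‖ ^ 2 := by gcongr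
    _ = ‖φ - χ‖ ^ 2 - ∑ l, ‖contractLeft B (v l) (φ - χ)‖ ^ 2 := by
      simpa only [hdiff, norm_sub_sum_tprod_contractLeft_sq hv] using
        norm_sub_sum_tprod_contractLeft_sq hv Finset.univ (φ - χ)
    _ ≤ ‖φ - χ‖ ^ 2 := sub_le_self _ (Finset.sum_nonneg fun _ _ => sq_nonneg _)

end SchmidtRankLE

theorem IsMaximallyEntangled.norm_sq_mul_le_norm_sub_sq {Ψ χ : Tensor A B} {L k : ℕ}
    (hΨ : IsMaximallyEntangled Ψ L) (hχ : SchmidtRankLE k χ) (c : ℂ) :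
    ‖c • Ψ‖ ^ 2 * (1 - k / L) ≤ ‖c • Ψ - χ‖ ^ 2 := by
  obtain ⟨hnorm, V, _, -, hρ⟩ := hΨ
  have hρΨ : ‖reducedDensity Ψ‖ ≤ (L : ℝ)⁻¹ := by
    rw [hρ, norm_smul, norm_inv, RCLike.norm_natCast]
    exact mul_le_of_le_one_right (by positivity) V.starProjection_norm_le
  refine le_trans ?_ (hχ.norm_sq_sub_le_norm_sub_sq (c • Ψ))
  rw [reducedDensity_smul, norm_smul, norm_smul, hnorm, mul_one, Complex.norm_real,
    Real.norm_of_nonneg (sq_nonneg _)]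
  calc ‖c‖ ^ 2 * (1 - k / L) = ‖c‖ ^ 2 - k * (‖c‖ ^ 2 * (L : ℝ)⁻¹) := by ring
    _ ≤ ‖c‖ ^ 2 - k * (‖c‖ ^ 2 * ‖reducedDensity Ψ‖) := by gcongr

theorem SchmidtDecomposition.exists_schmidtRankLE {φ : Tensor A B} (D : SchmidtDecomposition φ)
    {x : ℝ} (hx : 0 < x) (hxφ : x ≤ ‖reducedDensity φ‖) :
    ∃ k : ℕ, 0 < k ∧ ∃ χ : Tensor A B, SchmidtRankLE k χ ∧
      ‖φ - χ‖ ^ 2 = ‖φ‖ ^ 2 - h (reducedDensity φ) x - k * x := by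
  have hfin : {i | x ≤ D.weight i}.Finite := by
    simpa [Filter.eventually_cofinite] using
      D.hasSum_weight.summable.tendsto_cofinite_zero.eventually (gt_mem_nhds hx)
  let s := hfin.toFinset
  have hmem (i) : i ∈ s ↔ x ≤ D.weight i := hfin.mem_toFinset
  obtain ⟨i, hi⟩ := D.exists_le_weight hx hxφ
  refine ⟨s.card, Finset.card_pos.mpr ⟨i, (hmem i).mpr hi⟩, _,
    schmidtRankLE_sum s D.basis fun i => contractLeft B (D.basis i) φ, ?_⟩
  have hh : h (reducedDensity φ) x = ∑ i ∈ s, max (D.weight i - x) 0 :=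
    (D.hasSum_max_weight_sub hx.le).unique <| hasSum_sum_of_ne_finset_zero fun i hi =>
      max_eq_right (sub_nonpos.mpr (not_le.mp (mt (hmem i).mpr hi)).le)
  rw [norm_sub_sum_tprod_contractLeft_sq D.basis.orthonormal, hh,
    Finset.sum_congr rfl fun i hi => max_eq_left (sub_nonneg.mpr ((hmem i).mp hi)),
    Finset.sum_sub_distrib, Finset.sum_const, nsmul_eq_mul,
    Finset.sum_congr rfl fun i _ => D.norm_contractLeft_sq i]
  ring

end SchmidtRank

section Converse

theorem exists_eq_smul_of_hasSum_pureState {H ι : Type*} [NormedAddCommGroup H]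
    [InnerProductSpace ℂ H] {v : ι → H} {Ψ : H} {t : ℂ}
    (hv : HasSum (fun i => pureState (v i)) (t • pureState Ψ)) (i : ι) : ∃ c : ℂ, v i = c • Ψ := by
  suffices hmem : v i ∈ (ℂ ∙ Ψ)ᗮᗮ by
    rw [Submodule.orthogonal_orthogonal] at hmem
    exact (Submodule.mem_span_singleton.mp hmem).imp fun _ => Eq.symm
  refine (Submodule.mem_orthogonal _ _).mpr fun r hr => ?_
  have hΨr : ⟪Ψ, r⟫_ℂ = 0 := Submodule.mem_orthogonal_singleton_iff_inner_right.mp hr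
  have hzero := (hv.mapL (.apply ℂ H r)).mapL (innerSL ℂ r)
  simp only [ContinuousLinearMap.apply_apply, innerSL_apply_apply, inner_pureState_self,
    _root_.smul_apply, pureState_apply Ψ, hΨr, zero_smul, smul_zero, inner_zero_right] at hzero
  rw [← Complex.ofReal_zero, Complex.hasSum_ofReal,
    hasSum_zero_iff_of_nonneg fun _ => sq_nonneg _] at hzero
  simpa using congrFun hzero i

variable {A : QSystem.{u}} {B : QSystem.{v}} {n : ℕ} {P : LOCC A B n A B} {Φ : Tensor A B} {L : ℕ}

theorem isPFLEC_iff : IsPFLEC P Φ L ↔ ∃ Ψ : Tensor A B, IsMaximallyEntangled Ψ L ∧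
    ∃ t : ℂ, t ≠ 0 ∧ P.instrument 1 (pureState Φ) = t • pureState Ψ := by
  refine exists_congr fun Ψ => and_congr_right fun hΨ => ⟨fun hI => ?_, fun ⟨t, ht, hI⟩ => ?_⟩
  · have htrace : trace (P.instrument 1 (pureState Φ)) ≠ 0 := fun htrace => by
      have hnorm := norm_pureState Ψ
      rw [← hI, htrace, inv_zero, zero_smul, norm_zero, hΨ.1] at hnorm
      norm_num at hnorm
    exact ⟨_, htrace, (inv_smul_eq_iff₀ htrace).mp hI⟩
  · rw [hI, trace_smul, trace_pureState, hΨ.1, one_pow, Complex.ofReal_one, mul_one,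
      inv_smul_smul₀ ht]

theorem IsPFLEC.trace_mul_le_norm_sub_sq (hP : IsPFLEC P Φ L) {k : ℕ} {χ : Tensor A B}
    (hχ : SchmidtRankLE k χ) :
    (trace (P.instrument 1 (pureState Φ))).re * (1 - k / L) ≤ ‖Φ - χ‖ ^ 2 := by
  obtain ⟨Ψ, hΨ, t, -, hI⟩ := isPFLEC_iff.mp hP
  obtain ⟨D⟩ := P.nonempty_krausRepresentation
  have hbranch (w) : ‖D.kraus 1 w Φ‖ ^ 2 * (1 - k / L) ≤ ‖D.kraus 1 w (Φ - χ)‖ ^ 2 := by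
    obtain ⟨c, hc⟩ := exists_eq_smul_of_hasSum_pureState (hI ▸ D.hasSum_pureState 1 Φ) w
    obtain ⟨X, Y, hXY⟩ := D.exists_kraus_eq_tensorOp 1 w
    rw [map_sub, hc]
    exact hΨ.norm_sq_mul_le_norm_sub_sq (hXY ▸ hχ.tensorOp X Y) c
  have hs := (D.summable_norm_sq 1 Φ).hasSum
  rw [trace_of_hasSum_pureState hs (D.hasSum_pureState 1 Φ), Complex.ofReal_re]
  refine hasSum_le (fun w => (hbranch w).trans ?_) (hs.mul_right _)
    (D.hasSum_sum_norm_sq (Φ - χ))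
  exact Finset.single_le_sum (f := fun i => ‖D.kraus i w (Φ - χ)‖ ^ 2) (fun _ _ => sq_nonneg _)
    (Finset.mem_univ 1)

theorem IsPFLEC.size_mul_le {x : ℝ} (hP : IsPFLEC P Φ L) (hx : 0 < x)
    (hxΦ : x ≤ ‖reducedDensity Φ‖) (hfail : failureProb P Φ ≤ h (reducedDensity Φ) x) :
    L * x ≤ ‖Φ‖ ^ 2 - h (reducedDensity Φ) x := by
  obtain ⟨D⟩ := nonempty_schmidtDecomposition Φ
  obtain ⟨k, hk, χ, hχ, hdist⟩ := D.exists_schmidtRankLE hx hxΦ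
  have hkx : k * x ≤ ‖Φ‖ ^ 2 - h (reducedDensity Φ) x :=
    sub_nonneg.mp (hdist ▸ sq_nonneg _)
  have htrace := congrArg Complex.re (P.sum_trace_instrument_pureState Φ)
  rw [Fin.sum_univ_two, Complex.add_re, Complex.ofReal_re] at htrace
  rw [failureProb] at hfail
  rcases le_or_gt L k with hLk | hkL
  · calc (L : ℝ) * x ≤ k * x := by gcongr
      _ ≤ _ := hkx
  set s := ‖Φ‖ ^ 2 - h (reducedDensity Φ) x
  have hL : (0 : ℝ) < L := by exact_mod_cast hk.trans hkL
  have hfar : s * (1 - k / L) ≤ s - k * x :=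
    calc s * (1 - k / L) ≤ (trace (P.instrument 1 (pureState Φ))).re * (1 - k / L) := by
          refine mul_le_mul_of_nonneg_right (by linarith) (sub_nonneg.mpr ?_)
          exact (div_le_one hL).mpr (by exact_mod_cast hkL.le)
      _ ≤ s - k * x := hdist ▸ hP.trace_mul_le_norm_sub_sq hχ
  have hxs : k * x ≤ k * (s / L) := by
    linarith [show k * (s / L) = s - s * (1 - k / L) by ring]
  exact (le_div_iff₀' hL).mp (le_of_mul_le_mul_left hxs (by exact_mod_cast hk))

end Converse

section Sampling

open MeasureTheory Set Filter Topology

variable {ι : Type*}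

theorem hasSum_measureReal_inter {α : Type*} [MeasurableSpace α] {μ : Measure α} [Countable ι]
    {s : ι → Set α} {t : Set α} (hs : ∀ i, MeasurableSet (s i))
    (hdisj : Pairwise (Function.onFun Disjoint s)) (ht : MeasurableSet t) (hμt : μ t ≠ ⊤)
    (hts : t ⊆ ⋃ i, s i) :
    HasSum (fun i => μ.real (t ∩ s i)) (μ.real t) := by
  have htsum : μ t = ∑' i, μ (t ∩ s i) := by
    rw [← measure_iUnion (fun i j hij => (hdisj hij).mono inter_subset_right inter_subset_right)
      fun i => ht.inter (hs i), ← inter_iUnion, inter_eq_left.mpr hts]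
  simp only [measureReal_def]
  rw [htsum] at hμt ⊢
  rw [ENNReal.tsum_toReal_eq fun i => ENNReal.ne_top_of_tsum_ne_top hμt i]
  exact (ENNReal.summable_toReal hμt).hasSum

theorem Ioc_subset_iUnion_Ioc_succ_of_tendsto {f : ℕ → ℝ} {b : ℝ} (hf : Tendsto f atTop (𝓝 b)) :
    Ioc b (f 0) ⊆ ⋃ n, Ioc (f (n + 1)) (f n) := by
  classical
  intro u hu
  have hex : ∃ n, f n < u := (hf.eventually (gt_mem_nhds hu.1)).exists
  obtain ⟨n, hn⟩ := Nat.exists_eq_succ_of_ne_zero fun h0 : Nat.find hex = 0 =>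
    (h0 ▸ Nat.find_spec hex).not_ge hu.2
  have hlt : f (n + 1) < u := by simpa only [hn] using Nat.find_spec hex
  exact mem_iUnion.mpr ⟨n, hlt, not_lt.mp (Nat.find_min hex (hn ▸ Nat.lt_succ_self n))⟩

theorem exists_Ioc_partition_nat {q : ℕ → ℝ} {a : ℝ} (hq : ∀ n, 0 ≤ q n) (hqa : HasSum q a) :
    ∃ t : ℕ → ℝ, Pairwise (Function.onFun Disjoint fun n => Ioc (t n - q n) (t n)) ∧
      ⋃ n, Ioc (t n - q n) (t n) = Ioc 0 a := by
  let f : ℕ → ℝ := fun n => a - ∑ k ∈ Finset.range n, q k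
  have hsucc : ∀ n, f n - q n = f (n + 1) := fun n => by
    simp only [f, Finset.sum_range_succ]
    ring
  have hanti : Antitone f := antitone_nat_of_succ_le fun n => by linarith [hsucc n, hq n]
  have hlim : Tendsto f atTop (𝓝 0) := by
    simpa only [sub_self] using hqa.tendsto_sum_nat.const_sub a
  have hf0 : f 0 = a := by simp [f]
  refine ⟨f, ?_, ?_⟩
  · simp only [hsucc]
    exact hanti.pairwise_disjoint_on_Ioc_succ
  · simp only [hsucc, ← hf0]
    exact (iUnion_subset fun n => Ioc_subset_Ioc (hanti.le_of_tendsto hlim _)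
      (hanti (Nat.zero_le _))).antisymm (Ioc_subset_iUnion_Ioc_succ_of_tendsto hlim)

theorem exists_Ioc_partition [Countable ι] {q : ι → ℝ} {a : ℝ} (hq : ∀ i, 0 ≤ q i)
    (hqa : HasSum q a) :
    ∃ t : ι → ℝ, Pairwise (Function.onFun Disjoint fun i => Ioc (t i - q i) (t i)) ∧
      ⋃ i, Ioc (t i - q i) (t i) = Ioc 0 a := by
  obtain ⟨g, hg⟩ := exists_injective_nat ι
  let q' : ℕ → ℝ := Function.extend g q 0
  have hqg : ∀ i, q' (g i) = q i := hg.extend_apply q 0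
  have hq'_eq_zero : ∀ n, (¬∃ i, g i = n) → q' n = 0 := fun n hn =>
    Function.extend_apply' _ _ _ hn
  have hq' : ∀ n, 0 ≤ q' n := fun n => by
    by_cases hn : ∃ i, g i = n
    · obtain ⟨i, rfl⟩ := hn
      exact (hqg i).symm ▸ hq i
    · exact (hq'_eq_zero n hn).ge
  obtain ⟨t, hdisj, hcover⟩ := exists_Ioc_partition_nat hq' ((hasSum_extend_zero hg).mpr hqa)
  refine ⟨t ∘ g, fun i j hij => ?_, ?_⟩
  · simpa only [Function.onFun, Function.comp_apply, hqg] using hdisj (hg.ne hij)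
  · refine hcover ▸ (iUnion_subset fun i => ?_).antisymm (iUnion_subset fun n u hu => ?_)
    · exact hqg i ▸ subset_iUnion (fun n => Ioc (t n - q' n) (t n)) (g i)
    · obtain ⟨i, rfl⟩ : ∃ i, g i = n := by
        by_contra hni
        simp only [hq'_eq_zero n hni, sub_zero, Ioc_self, mem_empty_iff_false] at hu
      exact mem_iUnion.mpr ⟨i, hqg i ▸ hu⟩

theorem exists_injective_mem_of_partition {t q : ι → ℝ} {L : ℕ} (hq : ∀ i, q i ≤ 1)
    (hcover : Ioc 0 (L : ℝ) ⊆ ⋃ i, Ioc (t i - q i) (t i)) {u : ℝ} (hu : u ∈ Ioc (0 : ℝ) 1) :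
    ∃ σ : Fin L ↪ ι, ∀ l, u + l ∈ Ioc (t (σ l) - q (σ l)) (t (σ l)) := by
  have hmem : ∀ l : Fin L, ∃ i, u + l ∈ Ioc (t i - q i) (t i) := fun l => by
    have hl : (l : ℝ) + 1 ≤ L := by exact_mod_cast l.isLt
    exact mem_iUnion.mp (hcover ⟨by linarith [hu.1, (l : ℕ).cast_nonneg (α := ℝ)],
      by linarith [hu.2]⟩)
  choose σ hσ using hmem
  refine ⟨⟨σ, fun l l' hll' => ?_⟩, hσ⟩
  have hl := hσ l
  have hl' := hσ l'
  rw [hll'] at hl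
  have h₁ : (l : ℝ) < l' + 1 := by linarith [hl.2, hl'.1, hq (σ l')]
  have h₂ : (l' : ℝ) < l + 1 := by linarith [hl.1, hl'.2, hq (σ l')]
  norm_cast at h₁ h₂
  exact Fin.ext (by omega)

theorem sum_volume_inter_preimage_add_natCast {L : ℕ} {I : Set ℝ} (hI : MeasurableSet I)
    (hIL : I ⊆ Ioc 0 (L : ℝ)) :
    ∑ l : Fin L, volume.real (Ioc 0 1 ∩ (· + (l : ℝ)) ⁻¹' I) = volume.real I := by
  have hshift : ∀ l : Fin L, volume.real (Ioc 0 1 ∩ (· + (l : ℝ)) ⁻¹' I) =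
      volume.real (I ∩ Ioc (l : ℝ) ((l + 1 : ℕ) : ℝ)) := fun l => by
    rw [measureReal_def, measureReal_def, ← measure_preimage_add_right volume (l : ℝ) (I ∩ _),
      preimage_inter, inter_comm]
    simp
  have hcover : I ⊆ ⋃ l : Fin L, Ioc (l : ℝ) ((l + 1 : ℕ) : ℝ) := fun u hu => by
    have hpos : 0 < ⌈u⌉₊ := Nat.ceil_pos.mpr (hIL hu).1
    have hle : ⌈u⌉₊ ≤ L := Nat.ceil_le.mpr (hIL hu).2
    refine mem_iUnion.mpr ⟨⟨⌈u⌉₊ - 1, by omega⟩, Nat.lt_ceil.mp (by simp only; omega), ?_⟩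
    simpa only [Nat.sub_add_cancel hpos] using Nat.le_ceil u
  have hdisj : Pairwise (Function.onFun Disjoint
      fun l : Fin L => Ioc (l : ℝ) ((l + 1 : ℕ) : ℝ)) := fun l l' hll' =>
    Nat.mono_cast.pairwise_disjoint_on_Ioc_succ (Fin.val_ne_of_ne hll')
  simp only [hshift]
  exact (hasSum_fintype _).unique (hasSum_measureReal_inter (fun _ => measurableSet_Ioc) hdisj hI
    (measure_ne_top_of_subset hIL measure_Ioc_lt_top.ne) hcover)

/-- A sampling design without replacement: a probability distribution `w` on the samples of `L`
distinct elements of `ι`, for which `q i` is the probability that `i` is sampled. Samples are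
encoded as embeddings of `Fin L`, so that they come with an enumeration. -/
structure IsSamplingDesign {L : ℕ} (w : (Fin L ↪ ι) → ℝ) (q : ι → ℝ) : Prop where
  nonneg : ∀ σ, 0 ≤ w σ
  hasSum_one : HasSum w 1
  hasSum_inclusion : ∀ i, HasSum (fun σ => ∑ l, {l | σ l = i}.indicator (fun _ => w σ) l) (q i)

theorem IsSamplingDesign.hasSum_mul_sum {L : ℕ} {w : (Fin L ↪ ι) → ℝ} {q g : ι → ℝ}
    (hw : IsSamplingDesign w q) (hg : ∀ i, 0 ≤ g i) {a : ℝ} (ha : HasSum (fun i => q i * g i) a) :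
    HasSum (fun σ => w σ * ∑ l, g (σ l)) a := by
  refine hasSum_comm_of_nonneg (fun i σ => ?_) (fun i => (hw.hasSum_inclusion i).mul_right (g i)) ha
    fun σ => ?_
  · exact mul_nonneg
      (Finset.sum_nonneg fun l _ => Set.indicator_nonneg (fun _ _ => hw.nonneg σ) l) (hg i)
  · simp only [Finset.sum_mul, Finset.mul_sum]
    refine hasSum_sum fun l _ => ?_
    convert hasSum_single (σ l) fun i hi => ?_
    · rw [Set.indicator_of_mem (by exact rfl)]
    · rw [Set.indicator_of_notMem (by exact hi.symm), zero_mul]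

theorem exists_isSamplingDesign [Countable ι] {q : ι → ℝ} {L : ℕ} (hq0 : ∀ i, 0 ≤ q i)
    (hq1 : ∀ i, q i ≤ 1) (hqL : HasSum q L) : ∃ w : (Fin L ↪ ι) → ℝ, IsSamplingDesign w q := by
  obtain ⟨t, hdisj, hcover⟩ := exists_Ioc_partition hq0 hqL
  have : Countable (Fin L ↪ ι) := DFunLike.coe_injective.countable
  let I : ι → Set ℝ := fun i => Ioc (t i - q i) (t i)
  let E : (Fin L ↪ ι) → Set ℝ := fun σ => ⋂ l : Fin L, (· + (l : ℝ)) ⁻¹' I (σ l)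
  have hI : ∀ i, MeasurableSet (I i) := fun i => measurableSet_Ioc
  have hE_meas : ∀ σ, MeasurableSet (E σ) := fun σ =>
    .iInter fun l => measurable_add_const _ (hI (σ l))
  have hI_unique : ∀ {i j u}, u ∈ I i → u ∈ I j → i = j := fun hi hj =>
    hdisj.eq (not_disjoint_iff.mpr ⟨_, hi, hj⟩)
  have hE_disj : Pairwise (Function.onFun Disjoint E) := fun σ τ hστ =>
    disjoint_left.mpr fun u hσ hτ => hστ (DFunLike.ext _ _ fun l =>
      hI_unique (mem_iInter.mp hσ l) (mem_iInter.mp hτ l))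
  have hE_cover : Ioc (0 : ℝ) 1 ⊆ ⋃ σ, E σ := fun u hu => by
    obtain ⟨σ, hσ⟩ := exists_injective_mem_of_partition hq1 hcover.ge hu
    exact mem_iUnion.mpr ⟨σ, mem_iInter.mpr hσ⟩
  have hfinite : ∀ s : Set ℝ, volume (Ioc 0 1 ∩ s) ≠ ⊤ := fun s =>
    measure_ne_top_of_subset inter_subset_left measure_Ioc_lt_top.ne
  refine ⟨fun σ => volume.real (Ioc 0 1 ∩ E σ), fun σ => measureReal_nonneg, ?_, fun i => ?_⟩
  · simpa using hasSum_measureReal_inter (μ := volume) hE_meas hE_disj measurableSet_Ioc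
      measure_Ioc_lt_top.ne hE_cover
  · have hIL : volume.real (I i) = q i := by
      simp [I, hq0 i]
    rw [← hIL, ← sum_volume_inter_preimage_add_natCast (L := L) (hI i)
      (hcover ▸ subset_iUnion I i)]
    refine hasSum_sum fun l _ => ?_
    convert! hasSum_measureReal_inter hE_meas hE_disj
      (measurableSet_Ioc.inter (measurable_add_const _ (hI i))) (hfinite _)
      (inter_subset_left.trans hE_cover) using 2 with σ
    by_cases hσ : σ l = i
    · have hsub : E σ ⊆ (· + (l : ℝ)) ⁻¹' I i := hσ ▸ iInter_subset _ l
      rw [indicator_of_mem (show l ∈ {l | σ l = i} from hσ), inter_assoc,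
        inter_eq_right.mpr hsub]
    · have hdisj' : Disjoint ((· + (l : ℝ)) ⁻¹' I i) (E σ) := disjoint_left.mpr fun u hi hu =>
        hσ (hI_unique (mem_iInter.mp hu l) hi)
      rw [indicator_of_notMem (show l ∉ {l | σ l = i} from hσ), inter_assoc,
        hdisj'.inter_eq, inter_empty, measureReal_empty]

end Sampling

section Orthonormal

variable {H H' κ : Type*} [NormedAddCommGroup H] [InnerProductSpace ℂ H] [NormedAddCommGroup H']
  [InnerProductSpace ℂ H'] [Fintype κ]

theorem norm_sum_smul_sq {v : κ → H} (hv : Orthonormal ℂ v) (c : κ → ℂ) :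
    ‖∑ l, c l • v l‖ ^ 2 = ∑ l, ‖c l‖ ^ 2 := by
  have hself := inner_self_eq_norm_sq_to_K (𝕜 := ℂ) (∑ l, c l • v l)
  rw [hv.inner_sum, Finset.sum_congr rfl fun l _ => Complex.conj_mul' (c l)] at hself
  refine Complex.ofReal_injective ?_
  push_cast
  exact hself.symm

theorem sum_rankOne_apply (v : κ → H') (u : κ → H) (a : H) :
    (∑ l, InnerProductSpace.rankOne ℂ (v l) (u l)) a = ∑ l, ⟪u l, a⟫_ℂ • v l := by
  simp only [_root_.sum_apply, InnerProductSpace.rankOne_apply]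

theorem sum_pureState_eq_starProjection {v : κ → H} (hv : Orthonormal ℂ v)
    [(Submodule.span ℂ (Set.range v)).HasOrthogonalProjection] :
    ∑ l, pureState (v l) = (Submodule.span ℂ (Set.range v)).starProjection := by
  ext a
  refine (Submodule.eq_starProjection_of_mem_of_inner_eq_zero ?_ fun u hu => ?_).symm
  · rw [_root_.sum_apply]
    exact Submodule.sum_mem _ fun l _ => Submodule.smul_mem _ _ (Submodule.subset_span ⟨l, rfl⟩)
  · induction hu using Submodule.span_induction with
    | mem u hu =>
      obtain ⟨l, rfl⟩ := hu
      rw [← inner_conj_symm, inner_sub_right, _root_.sum_apply]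
      simp only [pureState_apply, hv.inner_right_fintype, sub_self, map_zero]
    | zero => exact inner_zero_right _
    | add u u' _ _ hu hu' => rw [inner_add_right, hu, hu', add_zero]
    | smul c u _ hu => rw [inner_smul_right, hu, mul_zero]

end Orthonormal

section MaximallyEntangled

variable {A : QSystem.{u}} {B : QSystem.{v}} {κ : Type*} [Fintype κ]

theorem reducedDensity_sum_tprod (e : κ → A) {f : κ → B} (hf : Orthonormal ℂ f) :
    reducedDensity (∑ l, tprod (e l) (f l)) = ∑ l, pureState (e l) := by
  ext a'
  refine ext_inner_left ℂ fun a => ?_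
  rw [inner_reducedDensity, map_sum, map_sum]
  simp only [contractLeft_tprod, hf.inner_sum, inner_conj_symm, _root_.sum_apply, pureState_apply,
    inner_sum, inner_smul_right]

theorem isMaximallyEntangled_sum_tprod [Nonempty κ] {e : κ → A} (he : Orthonormal ℂ e)
    {f : κ → B} (hf : Orthonormal ℂ f) :
    IsMaximallyEntangled ((√(Fintype.card κ) : ℂ)⁻¹ • ∑ l, tprod (e l) (f l)) (Fintype.card κ) := by
  have hcard : (0 : ℝ) < Fintype.card κ := Nat.cast_pos.mpr Fintype.card_pos
  have hnorm_coeff : ‖(√(Fintype.card κ) : ℂ)⁻¹‖ ^ 2 = (Fintype.card κ : ℝ)⁻¹ := by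
    rw [norm_inv, Complex.norm_real, Real.norm_eq_abs, inv_pow, sq_abs, Real.sq_sqrt hcard.le]
  have hdiag : Orthonormal ℂ fun l => tprod (e l) (f l) :=
    (orthonormal_tprod he hf).comp (fun l => (l, l)) fun _ _ hll' => congrArg Prod.fst hll'
  have hnorm_sum : ‖∑ l, tprod (e l) (f l)‖ ^ 2 = Fintype.card κ := by
    simpa using norm_sum_smul_sq hdiag 1
  have hfin := FiniteDimensional.span_of_finite ℂ (Set.finite_range e)
  refine ⟨?_, Submodule.span ℂ (Set.range e), hfin,
    finrank_span_eq_card he.linearIndependent, ?_⟩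
  · rw [← sq_eq_sq₀ (norm_nonneg _) zero_le_one, norm_smul, mul_pow, hnorm_coeff, hnorm_sum,
      inv_mul_cancel₀ hcard.ne', one_pow]
  · rw [reducedDensity_smul, hnorm_coeff, reducedDensity_sum_tprod e hf,
      sum_pureState_eq_starProjection he, Complex.ofReal_inv, Complex.ofReal_natCast]

end MaximallyEntangled

section Measurements

variable {A A₁ : QSystem.{u}} {ι κ : Type*}

/-- A measurement whose outcomes are numbered by an injection `g` of the outcome type into `ℕ`. The
numbers outside the range of `g` get the operator `0`. -/
def Measurement.extend {g : κ → ℕ} (hg : Function.Injective g) (K : κ → A →L[ℂ] A₁)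
    (hK : ∀ a, HasSum (fun k => ‖K k a‖ ^ 2) (‖a‖ ^ 2)) : Measurement A A₁ where
  K := Function.extend g K 0
  complete a := by
    rw [← hg.hasSum_iff fun n hn => ?_]
    · simpa only [Function.comp_def, hg.extend_apply] using hK a
    · rw [Function.extend_apply' _ _ _ hn]
      simp

theorem Measurement.extend_K_apply {g : κ → ℕ} (hg : Function.Injective g) (K : κ → A →L[ℂ] A₁)
    (hK : ∀ a, HasSum (fun k => ‖K k a‖ ^ 2) (‖a‖ ^ 2)) (k : κ) :
    (Measurement.extend hg K hK).K (g k) = K k :=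
  hg.extend_apply K 0 k

theorem Measurement.extend_K_of_notMem_range {g : κ → ℕ} (hg : Function.Injective g)
    (K : κ → A →L[ℂ] A₁) (hK : ∀ a, HasSum (fun k => ‖K k a‖ ^ 2) (‖a‖ ^ 2)) {n : ℕ}
    (hn : n ∉ Set.range g) : (Measurement.extend hg K hK).K n = 0 :=
  Function.extend_apply' _ _ n hn

theorem exists_measurement_map_orthonormal [Finite κ] {B : QSystem.{v}} {f g : κ → B}
    (hf : Orthonormal ℂ f) (hg : Orthonormal ℂ g) :
    ∃ M : Measurement B B, (∀ l, M.K 0 (f l) = g l) ∧ ∀ j ≠ 0, ∀ l, M.K j (f l) = 0 := by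
  classical
  have := Fintype.ofFinite κ
  let S : Submodule ℂ B := Submodule.span ℂ (Set.range f)
  have hfin : FiniteDimensional ℂ S := FiniteDimensional.span_of_finite ℂ (Set.finite_range f)
  let K : Fin 2 → B →L[ℂ] B :=
    ![∑ l, InnerProductSpace.rankOne ℂ (g l) (f l), Sᗮ.starProjection]
  have hproj : ∀ b, ‖S.starProjection b‖ ^ 2 = ‖K 0 b‖ ^ 2 := fun b => by
    calc ‖S.starProjection b‖ ^ 2 = ‖∑ l, ⟪f l, b⟫_ℂ • f l‖ ^ 2 := by
          rw [← sum_pureState_eq_starProjection hf, _root_.sum_apply]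
          rfl
      _ = ‖∑ l, ⟪f l, b⟫_ℂ • g l‖ ^ 2 := by rw [norm_sum_smul_sq hf, norm_sum_smul_sq hg]
      _ = ‖K 0 b‖ ^ 2 := by rw [← sum_rankOne_apply]; rfl
  have hK : ∀ b, HasSum (fun j => ‖K j b‖ ^ 2) (‖b‖ ^ 2) := fun b => by
    have hsum := hasSum_fintype fun j => ‖K j b‖ ^ 2
    rw [Fin.sum_univ_two, ← hproj, show K 1 = Sᗮ.starProjection from rfl] at hsum
    simp only [Submodule.starProjection_apply, ← Submodule.coe_norm] at hsum
    rwa [← S.norm_sq_eq_add_norm_sq_projection] at hsum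
  let M : Measurement B B := .extend Fin.val_injective K hK
  have hM0 : M.K 0 = K 0 := Measurement.extend_K_apply Fin.val_injective K hK 0
  have hM1 : M.K 1 = K 1 := Measurement.extend_K_apply Fin.val_injective K hK 1
  refine ⟨M, fun l => ?_, fun j hj l => ?_⟩
  · rw [hM0]
    refine (sum_rankOne_apply g f (f l)).trans ?_
    simp only [orthonormal_iff_ite.mp hf, ite_smul, one_smul, zero_smul, Finset.sum_ite_eq',
      Finset.mem_univ, if_true]
  · by_cases hj1 : j = 1
    · rw [hj1, hM1]
      exact Sᗮ.starProjection_apply_eq_zero_iff.mpr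
        (S.le_orthogonal_orthogonal (Submodule.subset_span ⟨l, rfl⟩))
    · rw [Measurement.extend_K_of_notMem_range, zero_apply]
      rintro ⟨i, rfl⟩
      omega

theorem hasSum_norm_sumElim_sq (e : HilbertBasis ι ℂ A) {r : ι → ℝ} (hr : ∀ i, r i ≤ 1)
    {K : κ → A →L[ℂ] A} {a : A} {s : ℝ} (hK : HasSum (fun k => ‖K k a‖ ^ 2) s)
    (hs : HasSum (fun i => r i * ‖⟪e i, a⟫_ℂ‖ ^ 2) s) :
    HasSum (fun y => ‖Sum.elim (fun i => (√(1 - r i) : ℂ) • pureState (e i)) K y a‖ ^ 2)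
      (‖a‖ ^ 2) := by
  rw [← sub_add_cancel (‖a‖ ^ 2) s]
  refine HasSum.sum (((hasSum_norm_inner_sq e a).sub hs).congr_fun fun i => ?_) hK
  rw [Function.comp_apply, Sum.elim_inl, _root_.smul_apply, norm_smul, pureState_apply, norm_smul,
    e.orthonormal.1, mul_one, mul_pow, Complex.norm_real, Real.norm_eq_abs, sq_abs,
    Real.sq_sqrt (sub_nonneg.mpr (hr i)), sub_mul, one_mul]

end Measurements

section Protocol

variable {A A₁ : QSystem.{u}} {B B₁ : QSystem.{v}} {κ : Type*}

theorem instrument_alice_extend {n : ℕ} {g : κ → ℕ} (hg : Function.Injective g)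
    (K : κ → A →L[ℂ] A₁) (hK : ∀ a, HasSum (fun k => ‖K k a‖ ^ 2) (‖a‖ ^ 2))
    (next : κ → LOCC A₁ B n A₁ B) (φ : Tensor A B) (i : Fin 2) :
    (LOCC.alice A₁ (.extend hg K hK)
        (Function.extend g next fun _ => .finish 0)).instrument i (pureState φ) =
      ∑' k, (next k).instrument i (pureState (tensorOp (K k) (.id ℂ B) φ)) := by
  rw [LOCC.instrument]
  simp only [comp_pureState_comp_adjoint]
  rw [← hg.tsum_eq]
  · simp only [hg.extend_apply, Measurement.extend_K_apply]
  · refine Function.support_subset_iff'.mpr fun n hn => ?_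
    rw [Measurement.extend_K_of_notMem_range hg K hK hn, tensorOp_zero_left,
      Function.extend_apply' _ _ n hn, zero_apply, pureState, map_zero, LOCC.instrument, ite_self]

theorem instrument_bob_finish (N : Measurement B B₁) {φ : Tensor A B}
    (hN : ∀ j ≠ 0, tensorOp (.id ℂ A) (N.K j) φ = 0) :
    (LOCC.bob (n := 0) B₁ N fun _ => .finish 1).instrument 1 (pureState φ) =
      pureState (tensorOp (.id ℂ A) (N.K 0) φ) := by
  rw [LOCC.instrument]
  simp only [comp_pureState_comp_adjoint, LOCC.instrument, if_true]
  refine tsum_eq_single 0 fun j hj => ?_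
  rw [hN j hj, pureState, map_zero]

theorem exists_locc_instrument_one_eq_smul_pureState {ι : Type*} [Countable ι] [Countable κ]
    {K : ι ⊕ κ → A →L[ℂ] A} (hK : ∀ a, HasSum (fun y => ‖K y a‖ ^ 2) (‖a‖ ^ 2))
    (N : κ → Measurement B B) {φ ψ : Tensor A B} {c : κ → ℂ} {t : ℝ}
    (hc : HasSum (fun k => ‖c k‖ ^ 2) t)
    (hN₀ : ∀ k, tensorOp (.id ℂ A) ((N k).K 0) (tensorOp (K (.inr k)) (.id ℂ B) φ) = c k • ψ)
    (hN : ∀ k, ∀ j ≠ 0, tensorOp (.id ℂ A) ((N k).K j) (tensorOp (K (.inr k)) (.id ℂ B) φ) = 0) :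
    ∃ P : LOCC A B 2 A B, P.instrument 1 (pureState φ) = (t : ℂ) • pureState ψ := by
  obtain ⟨g, hg⟩ := exists_injective_nat (ι ⊕ κ)
  let next : ι ⊕ κ → LOCC A B 1 A B :=
    Sum.elim (fun _ => .finish 0) fun k => .bob B (N k) fun _ => .finish 1
  refine ⟨.alice A (.extend hg K hK) (Function.extend g next fun _ => .finish 0), ?_⟩
  rw [instrument_alice_extend]
  have hfailure : HasSum (fun i : ι => (next (.inl i)).instrument 1
      (pureState (tensorOp (K (.inl i)) (.id ℂ B) φ))) 0 := by
    convert hasSum_zero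
    simp only [next, Sum.elim_inl, LOCC.instrument, one_ne_zero, if_false]
  have hsuccess : HasSum (fun k => (next (.inr k)).instrument 1
      (pureState (tensorOp (K (.inr k)) (.id ℂ B) φ))) ((t : ℂ) • pureState ψ) := by
    refine ((Complex.hasSum_ofReal.mpr hc).smul_const _).congr_fun fun k => ?_
    simp only [next, Sum.elim_inr, instrument_bob_finish (N k) (hN k), hN₀, pureState_smul]
  simpa only [zero_add] using (HasSum.sum (f := fun y => (next y).instrument 1
    (pureState (tensorOp (K y) (.id ℂ B) φ))) hfailure hsuccess).tsum_eq

end Protocol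

section Achievability

variable {A : QSystem.{u}} {B : QSystem.{v}} {φ : Tensor A B} {L : ℕ}

namespace SchmidtDecomposition

variable (D : SchmidtDecomposition φ)

/-- The local filter on the left system that equalizes the Schmidt coefficients at the indices
`σ l` and relabels the Schmidt vectors `σ l` as `τ l`. -/
def filter (σ τ : Fin L ↪ D.Support) : A →L[ℂ] A :=
  ∑ l, (√(D.weight (σ l)) : ℂ)⁻¹ •
    InnerProductSpace.rankOne ℂ (D.basis (τ l)) (D.basis (σ l))

theorem tensorOp_filter (σ τ : Fin L ↪ D.Support) :
    tensorOp (D.filter σ τ) (.id ℂ B) φ =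
      ∑ l, tprod (D.basis (τ l)) (D.rightVector (σ l)) := by
  simp only [filter, tensorOp_sum_left, tensorOp_smul_left, _root_.sum_apply, _root_.smul_apply,
    tensorOp_rankOne_left, rightVector, tprod_smul_right]

theorem norm_filter_apply_sq (σ τ : Fin L ↪ D.Support) (a : A) :
    ‖D.filter σ τ a‖ ^ 2 = ∑ l, ‖⟪D.basis (σ l), a⟫_ℂ‖ ^ 2 / D.weight (σ l) := by
  have hτ : Orthonormal ℂ fun l => D.basis (τ l) :=
    D.basis.orthonormal.comp _ (Subtype.val_injective.comp τ.injective)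
  have hfilter : D.filter σ τ a =
      ∑ l, ((√(D.weight (σ l)) : ℂ)⁻¹ * ⟪D.basis (σ l), a⟫_ℂ) • D.basis (τ l) := by
    simp only [filter, _root_.sum_apply, _root_.smul_apply, InnerProductSpace.rankOne_apply,
      smul_smul]
  rw [hfilter, norm_sum_smul_sq hτ]
  refine Finset.sum_congr rfl fun l _ => ?_
  rw [norm_mul, norm_inv, Complex.norm_real, Real.norm_eq_abs, mul_pow, inv_pow, sq_abs,
    Real.sq_sqrt (σ l).2.le, inv_mul_eq_div]

theorem hasSum_min_weight_support {x : ℝ} (hx : 0 ≤ x) :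
    HasSum (fun i : D.Support => min (D.weight i) x) (‖φ‖ ^ 2 - h (reducedDensity φ) x) := by
  refine (hasSum_subtype_iff_of_support_subset fun i hi => ?_).mpr (D.hasSum_min_weight hx)
  refine (D.weight_nonneg i).lt_of_ne fun hweight => hi ?_
  simp only [← hweight, min_eq_left hx]

theorem exists_isSamplingDesign {x : ℝ} (hx : 0 ≤ x) (ht : 0 < ‖φ‖ ^ 2 - h (reducedDensity φ) x)
    (hLx : L * x ≤ ‖φ‖ ^ 2 - h (reducedDensity φ) x) :
    ∃ w : (Fin L ↪ D.Support) → ℝ, IsSamplingDesign w fun i =>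
      L / (‖φ‖ ^ 2 - h (reducedDensity φ) x) * min (D.weight i) x := by
  have := D.countable_index
  set t : ℝ := ‖φ‖ ^ 2 - h (reducedDensity φ) x
  refine Entanglement.exists_isSamplingDesign (fun i => ?_) (fun i => ?_) ?_
  · have := i.2
    positivity
  · calc L / t * min (D.weight i) x ≤ L / t * x := by gcongr; exact min_le_right _ _
      _ = L * x / t := div_mul_eq_mul_div _ _ _
      _ ≤ 1 := (div_le_one ht).mpr hLx
  · have hsum : HasSum _ (L / t * t) := (D.hasSum_min_weight_support hx).mul_left (L / t)
    rwa [div_mul_cancel₀ _ ht.ne'] at hsum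

theorem hasSum_norm_smul_filter_sq {x t : ℝ} (ht : 0 < t) (hL : 0 < L)
    {w : (Fin L ↪ D.Support) → ℝ}
    (hw : IsSamplingDesign w fun i => L / t * min (D.weight i) x) (τ : Fin L ↪ D.Support)
    {a : A} {s : ℝ}
    (hs : HasSum (fun i => min (D.weight i) x / D.weight i * ‖⟪D.basis i, a⟫_ℂ‖ ^ 2) s) :
    HasSum (fun σ => ‖((√(t * w σ / L) : ℂ) • D.filter σ τ) a‖ ^ 2) s := by
  have hL' : (0 : ℝ) < L := Nat.cast_pos.mpr hL
  have hsub : HasSum (fun i : D.Support => L / t * min (D.weight i) x *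
      (t / L * (‖⟪D.basis i, a⟫_ℂ‖ ^ 2 / D.weight i))) s := by
    refine ((hasSum_subtype_iff_of_support_subset (s := {i | 0 < D.weight i})
      fun i hi => ?_).mpr hs).congr_fun fun i => ?_
    · refine (D.weight_nonneg i).lt_of_ne fun hweight => hi ?_
      simp only [← hweight, div_zero, zero_mul]
    · have : D.weight i ≠ 0 := ne_of_gt i.2
      simp only [Function.comp_apply]
      field_simp
  refine (hw.hasSum_mul_sum
    (g := fun i : D.Support => t / L * (‖⟪D.basis i, a⟫_ℂ‖ ^ 2 / D.weight i))
    (fun i => ?_) hsub).congr_fun fun σ => ?_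
  · have := i.2
    positivity
  · rw [_root_.smul_apply, norm_smul, mul_pow, Complex.norm_real, Real.norm_eq_abs, sq_abs,
      Real.sq_sqrt (div_nonneg (mul_nonneg ht.le (hw.nonneg σ)) hL'.le), norm_filter_apply_sq,
      ← Finset.mul_sum]
    ring

theorem summable_min_weight_div {x : ℝ} (hx : 0 ≤ x) (a : A) :
    Summable fun i => min (D.weight i) x / D.weight i * ‖⟪D.basis i, a⟫_ℂ‖ ^ 2 := by
  refine (hasSum_norm_inner_sq D.basis a).summable.of_nonneg_of_le (fun i => ?_) fun i => ?_
  · have := D.weight_nonneg i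
    positivity
  · exact mul_le_of_le_one_left (sq_nonneg _)
      (div_le_one_of_le₀ (min_le_left _ _) (D.weight_nonneg i))

theorem exists_measurement_tensorOp_filter (σ τ : Fin L ↪ D.Support) : ∃ N : Measurement B B,
    tensorOp (.id ℂ A) (N.K 0) (tensorOp (D.filter σ τ) (.id ℂ B) φ) =
        ∑ l, tprod (D.basis (τ l)) (D.rightVector (τ l)) ∧
      ∀ j ≠ 0, tensorOp (.id ℂ A) (N.K j) (tensorOp (D.filter σ τ) (.id ℂ B) φ) = 0 := by
  obtain ⟨N, hN₀, hN⟩ := exists_measurement_map_orthonormal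
    (D.orthonormal_rightVector.comp σ σ.injective) (D.orthonormal_rightVector.comp τ τ.injective)
  simp only [Function.comp_apply] at hN₀ hN
  refine ⟨N, ?_, fun j hj => ?_⟩
  · simp only [tensorOp_filter, map_sum, tensorOp_tprod, ContinuousLinearMap.id_apply, hN₀]
  · simp only [tensorOp_filter, map_sum, tensorOp_tprod, ContinuousLinearMap.id_apply, hN j hj]
    exact Finset.sum_eq_zero fun l _ => map_zero (tensorLeft B (D.basis (τ l)))

theorem isMaximallyEntangled_schmidt (hL : 0 < L) (σ : Fin L ↪ D.Support) :
    IsMaximallyEntangled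
      ((√L : ℂ)⁻¹ • ∑ l, tprod (D.basis (σ l)) (D.rightVector (σ l))) L := by
  have : Nonempty (Fin L) := ⟨⟨0, hL⟩⟩
  simpa only [Fintype.card_fin, Function.comp_apply] using isMaximallyEntangled_sum_tprod
    (D.basis.orthonormal.comp _ (Subtype.val_injective.comp σ.injective))
    (D.orthonormal_rightVector.comp σ σ.injective)

end SchmidtDecomposition

theorem exists_locc_instrument_one_isMaximallyEntangled {x : ℝ} (hx : 0 < x) (hL : 0 < L)
    (hLx : L * x ≤ ‖φ‖ ^ 2 - h (reducedDensity φ) x) :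
    ∃ (P : LOCC A B 2 A B) (Ψ : Tensor A B), IsMaximallyEntangled Ψ L ∧
      P.instrument 1 (pureState φ) =
        ((‖φ‖ ^ 2 - h (reducedDensity φ) x : ℝ) : ℂ) • pureState Ψ := by
  obtain ⟨D⟩ := nonempty_schmidtDecomposition φ
  have := D.countable_index
  have hcount : Countable (Fin L ↪ D.Support) := DFunLike.coe_injective.countable
  set t : ℝ := ‖φ‖ ^ 2 - h (reducedDensity φ) x
  have hL' : (0 : ℝ) < L := Nat.cast_pos.mpr hL
  have ht : 0 < t := (mul_pos hL' hx).trans_le hLx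
  obtain ⟨w, hw⟩ := D.exists_isSamplingDesign hx.le ht hLx
  obtain ⟨σ₀⟩ : Nonempty (Fin L ↪ D.Support) := by
    by_contra! hempty
    exact one_ne_zero (hw.hasSum_one.unique hasSum_empty)
  have hr (i : D.Index) : min (D.weight i) x / D.weight i ≤ 1 :=
    div_le_one_of_le₀ (min_le_left _ _) (D.weight_nonneg i)
  have hcomplete (a : A) := hasSum_norm_sumElim_sq D.basis hr
    (D.hasSum_norm_smul_filter_sq ht hL hw σ₀ (D.summable_min_weight_div hx.le a).hasSum)
    (D.summable_min_weight_div hx.le a).hasSum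
  choose N hN₀ hN using fun σ => D.exists_measurement_tensorOp_filter σ σ₀
  have hcoeff : HasSum (fun σ => ‖((√(t * w σ / L) * √L : ℝ) : ℂ)‖ ^ 2) t := by
    convert! hw.hasSum_one.mul_left t using 2 with σ
    · rw [Complex.norm_real, Real.norm_eq_abs, sq_abs, mul_pow, Real.sq_sqrt hL'.le,
        Real.sq_sqrt (div_nonneg (mul_nonneg ht.le (hw.nonneg σ)) hL'.le),
        div_mul_cancel₀ _ hL'.ne']
    · rw [mul_one]
  have hsqrt : (√L : ℂ) ≠ 0 := Complex.ofReal_ne_zero.mpr (Real.sqrt_pos.mpr hL').ne'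
  obtain ⟨P, hP⟩ := exists_locc_instrument_one_eq_smul_pureState hcomplete N hcoeff (φ := φ)
    (ψ := (√L : ℂ)⁻¹ • ∑ l, tprod (D.basis (σ₀ l)) (D.rightVector (σ₀ l)))
    (fun σ => by
      rw [Sum.elim_inr, tensorOp_smul_left, _root_.smul_apply, map_smul, hN₀, Complex.ofReal_mul,
        mul_smul, smul_inv_smul₀ hsqrt])
    fun σ j hj => by
      rw [Sum.elim_inr, tensorOp_smul_left, _root_.smul_apply, map_smul, hN σ j hj, smul_zero]
  exact ⟨P, _, D.isMaximallyEntangled_schmidt hL σ₀, hP⟩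

theorem exists_isPFLEC {x : ℝ} (hx : 0 < x) (hL : 0 < L)
    (hLx : L * x ≤ ‖φ‖ ^ 2 - h (reducedDensity φ) x) :
    ∃ P : LOCC A B 2 A B, IsPFLEC P φ L ∧ failureProb P φ = h (reducedDensity φ) x := by
  obtain ⟨P, Ψ, hΨ, hP⟩ := exists_locc_instrument_one_isMaximallyEntangled hx hL hLx
  have ht := (mul_pos (Nat.cast_pos.mpr hL) hx).trans_le hLx
  refine ⟨P, isPFLEC_iff.mpr ⟨Ψ, hΨ, _, Complex.ofReal_ne_zero.mpr ht.ne', hP⟩, ?_⟩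
  have htrace := congrArg Complex.re (P.sum_trace_instrument_pureState φ)
  rw [Fin.sum_univ_two, hP, trace_smul, trace_pureState, hΨ.1, Complex.add_re, one_pow,
    Complex.ofReal_one, mul_one, Complex.ofReal_re, Complex.ofReal_re] at htrace
  rw [failureProb]
  linarith

end Achievability

end

end Entanglement

theorem mainTheorem3 (A : QSystem.{u}) (B : QSystem.{v})
    (Φ : Entanglement.Tensor A B) (hΦ : ‖Φ‖ = 1)
    (x : ℝ) (hx : 0 < x) (hx' : x ≤ ‖Entanglement.reducedDensity Φ‖) :
    IsGreatest
      {L : ℕ | ∃ (n : ℕ) (P : Entanglement.LOCC A B n A B),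
        Entanglement.IsPFLEC P Φ L ∧
          Entanglement.failureProb P Φ ≤ Entanglement.h (Entanglement.reducedDensity Φ) x}
      ⌊(1 - Entanglement.h (Entanglement.reducedDensity Φ) x) / x⌋₊ := by
  have hle := Entanglement.le_norm_sq_sub_h hx hx'
  rw [hΦ, one_pow] at hle
  have hone : 1 ≤ (1 - Entanglement.h (Entanglement.reducedDensity Φ) x) / x :=
    (one_le_div hx).mpr hle
  refine ⟨?_, ?_⟩
  · have hfloor := (le_div_iff₀ hx).mp (Nat.floor_le (zero_le_one.trans hone))
    obtain ⟨P, hP, hfail⟩ := Entanglement.exists_isPFLEC hx (Nat.floor_pos.mpr hone)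
      (by rwa [hΦ, one_pow])
    exact ⟨2, P, hP, hfail.le⟩
  · rintro L ⟨n, P, hP, hfail⟩
    have hsize := hP.size_mul_le hx hx' hfail
    rw [hΦ, one_pow] at hsize
    exact Nat.le_floor ((le_div_iff₀ hx).mpr hsize)
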